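/- **Stop-loss optimality in dynamic reinsurance.** *Model.* Let $(Y_k,Z_k)_{k\ge 1}$ be independent pairs of random variables with $Y_k\ge 0$ integrable (claims) and $Z_k\ge 0$ bounded (premium income), where $Y_k$ and $Z_k$ are independent for each $k$ (for instance i.i.d. pairs with independent components). Let $\mathcal F$ be the set of retained loss functions, i.e. of all $f:\mathbb R_+\to\mathbb R_+$ with $f(t)\le t$ such that $f$ and $\mathrm{id}-f$ are increasing, with the topology of compact convergence and its Borel $\sigma$-algebra. The reinsurance premium is given by the expected premium principle $\pi_k(f)=(1+\theta)\,\mathbb E[Y_k-f(Y_k)]$ with $\theta>0$; put $\hat z_k=\operatorname{ess\,sup} Z_k$. There is no budget constraint. If the treaty $f\in\mathcal F$ is chosen at time $n$ in surplus $x$, the next surplus is $x-f(Y_{n+1})-\pi_{n+1}(f)+Z_{n+1}$, and the one-stage cost is $c_{n+1}(f)=f(Y_{n+1})+\pi_{n+1}(f)+\hat z_{n+1}-Z_{n+1}$. Let $\beta\in(0,1]$, $N\in\mathbb N$, and let $g:\mathbb R\to\mathbb R$ be increasing, convex and $L$-Lipschitz with $0\le g(x)\le Lx^++r$ for some constants $L\ge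 0$ and $r$. *Inner problem.* Minimize $\mathbb E\big[g\big(\sum_{k=0}^{N-1}\beta^k c_{k+1}(d_k(H_k))\big)\big]$ over all policies $(d_0,\dots,d_{N-1})$ of measurable, history-dependent decision rules with values in $\mathcal F$, where $H_k$ is the history of surpluses and treaties up to time $k$. *Extended problem.* On $\widehat E=\mathbb R\times\mathbb R_+\times(0,1]$, with states $(x,s,t)$ and next state $\big(x-f(Y_{n+1})-\pi_{n+1}(f)+Z_{n+1},\ s+t\,c_{n+1}(f),\ \beta t\big)$ at time $n$ under $f$, let $V_{n\pi}(h_n)$ be the conditional expectation of $g\big(s_n+t_n\sum_{k=n}^{N-1}\beta^{k-n}c_{k+1}(d_k(H_k))\big)$ given the history $h_n$ (of extended states and treaties) at time $n$ under a history-dependent policy $\pi$, let $V_n(h_n)=\inf_\pi V_{n\pi}(h_n)$, and let $J_n(x,s,t)$ be the infimum over Markov policies only (measurable decision rules $d_k:\widehat E\to\mathcal F$). *Claim.* Write $f_a(x)=\min\{x,a\}$ for $a\in[0,\infty]$ (stop-loss treaties). All expectations involved are finite, and: 1. For every $k$ and every $f\in\mathcal F$ there is an $a_f\in[0,\infty]$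 with $\min\{Y_k,a_f\}\le_{cx} f(Y_k)$ (convex order). 2. For $0\le n\le N$, $V_n(h_n)=J_n(x_n,s_n,t_n)$ for every history $h_n$, and $(x,s)\mapsto J_n(x,s,t)$ is convex for every $t\in(0,1]$. 3. $J_N(x,s,t)=g(s)$. For $n<N$ and $(x,s,t)\in\widehat E$ put $L_nJ_{n+1}(x,s,t,f)=\mathbb E\big[J_{n+1}\big(x-f(Y_{n+1})-\pi_{n+1}(f)+Z_{n+1},\ s+t\,c_{n+1}(f),\ \beta t\big)\big]$. If $\min\{Y_{n+1},a\}\le_{cx}f(Y_{n+1})$, then $L_nJ_{n+1}(x,s,t,f_a)\le L_nJ_{n+1}(x,s,t,f)$. Moreover $$J_n(x,s,t)=\min_{f\in\mathcal F}L_nJ_{n+1}(x,s,t,f)=\min_{a\in[0,\infty]}L_nJ_{n+1}(x,s,t,f_a),$$ and both minima are attained. 4. There are measurable $a_n:\widehat E\to[0,\infty]$, $n=0,\dots,N-1$, such that $a_n(x,s,t)$ attains the last minimum for all $(x,s,t)\in\widehat E$. For every such choice the Markov policy with the stop-loss decision rules $d_n(x,s,t)=f_{a_n(x,s,t)}$ is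 optimal: $V_{n\pi}(h_n)=V_n(h_n)$ for all $n\le N$ and all $h_n$. The corresponding policy of the original model, $h_n\mapsto f_{a_n(x_n,s_n,\beta^n)}$ with $s_n=\sum_{k<n}\beta^k(x_k-x_{k+1}+\hat z_{k+1})$, solves the inner problem for every initial surplus $x$, and its value is $J_0(x,0,1)$. So the inner problem has an optimal policy which uses a stop-loss treaty at every stage. -/

import Mathlib

open MeasureTheory ProbabilityTheory
open scoped NNReal ENNReal

namespace Reinsurance

/-! ### Retained loss functions -/

/-- `f : ℝ₊ → ℝ₊` lies below the identity, and both `f` and `id - f` are increasing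
(the subtraction in `ℝ≥0` is a genuine one, as `f t ≤ t`). -/
def IsRetainedLoss (f : ℝ≥0 → ℝ≥0) : Prop :=
  (∀ t, f t ≤ t) ∧ Monotone f ∧ Monotone fun t => t - f t

/-- Such functions are automatically continuous (even 1-Lipschitz), so that passing to
`C(ℝ≥0, ℝ≥0)` below loses none of them. -/
theorem IsRetainedLoss.lipschitz {f : ℝ≥0 → ℝ≥0} (hf : IsRetainedLoss f) :
    LipschitzWith 1 f := by
  obtain ⟨h1, h2, h3⟩ := hf
  have key : ∀ x y : ℝ≥0, x ≤ y → |(f x : ℝ) - f y| ≤ |(x : ℝ) - y| := by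
    intro x y hxy
    have a1 : (f x : ℝ) ≤ f y := h2 hxy
    have a2 : ((x - f x : ℝ≥0) : ℝ) ≤ ((y - f y : ℝ≥0) : ℝ) := h3 hxy
    rw [NNReal.coe_sub (h1 x), NNReal.coe_sub (h1 y)] at a2
    have a3 : (x : ℝ) ≤ y := hxy
    rw [abs_of_nonpos (by linarith), abs_of_nonpos (by linarith)]
    linarith
  refine LipschitzWith.of_dist_le_mul fun x y => ?_
  rw [NNReal.coe_one, one_mul, NNReal.dist_eq, NNReal.dist_eq]
  rcases le_total x y with h | h
  · exact key x y h
  · rw [abs_sub_comm, abs_sub_comm (x : ℝ)]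
    exact key y x h

/-- The set of admissible retained loss functions; this is the action space. -/
def RetainedLoss : Type := {f : C(ℝ≥0, ℝ≥0) // IsRetainedLoss f}

/-- The topology of compact convergence. -/
instance : TopologicalSpace RetainedLoss :=
  inferInstanceAs (TopologicalSpace {f : C(ℝ≥0, ℝ≥0) // IsRetainedLoss f})

instance : MeasurableSpace RetainedLoss := borel RetainedLoss

instance : BorelSpace RetainedLoss := ⟨rfl⟩

instance : CoeFun RetainedLoss fun _ => ℝ≥0 → ℝ≥0 := ⟨fun f => f.1⟩

/-- The function `x ↦ min {x, a}` with `a ∈ [0, ∞]`. -/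
noncomputable def stopLossFun (a : ℝ≥0∞) (x : ℝ≥0) : ℝ≥0 := (min (x : ℝ≥0∞) a).toNNReal

theorem coe_stopLossFun (a : ℝ≥0∞) (x : ℝ≥0) :
    (stopLossFun a x : ℝ≥0∞) = min (x : ℝ≥0∞) a :=
  ENNReal.coe_toNNReal (ne_top_of_le_ne_top ENNReal.coe_ne_top (min_le_left _ _))

theorem isRetainedLoss_stopLossFun (a : ℝ≥0∞) : IsRetainedLoss (stopLossFun a) := by
  induction a with
  | top => simp [IsRetainedLoss, stopLossFun, Monotone]
  | coe a =>
    have h : stopLossFun (a : ℝ≥0∞) = fun x => min x a := by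
      funext x
      rw [← ENNReal.coe_inj, coe_stopLossFun, ENNReal.coe_min]
    rw [h]
    refine ⟨fun t => min_le_left _ _, fun x y hxy => min_le_min_right _ hxy, fun x y hxy => ?_⟩
    have e : ∀ t : ℝ≥0, t - min t a = t - a := fun t => by
      rcases le_total t a with ht | ht
      · rw [min_eq_left ht, tsub_self, tsub_eq_zero_of_le ht]
      · rw [min_eq_right ht]
    simp only [e]
    exact tsub_le_tsub_right hxy a

/-- The stop-loss treaty `x ↦ min {x, a}`, `a ∈ [0, ∞]`. -/
noncomputable def stopLoss (a : ℝ≥0∞) : RetainedLoss :=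
  ⟨⟨stopLossFun a, (isRetainedLoss_stopLossFun a).lipschitz.continuous⟩,
    isRetainedLoss_stopLossFun a⟩

/-! ### Convex order -/

/-- `X ≤_cx Y` for integrable `X`, `Y`: `E ψ(X) ≤ E ψ(Y)` for every convex `ψ : ℝ → ℝ`. For
integrable `X`, `Y` both expectations exist in `(-∞, ∞]`, so nothing is claimed if
`E ψ(Y) = ∞`, and finiteness of `E ψ(X)` is part of the claim if `E ψ(Y) < ∞`. -/
def ConvexOrder {Ω : Type*} [MeasurableSpace Ω] (P : Measure Ω) (X Y : Ω → ℝ) : Prop :=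
  Integrable X P ∧ Integrable Y P ∧
    ∀ ψ : ℝ → ℝ, ConvexOn ℝ Set.univ ψ → Integrable (fun ω => ψ (Y ω)) P →
      Integrable (fun ω => ψ (X ω)) P ∧ ∫ ω, ψ (X ω) ∂P ≤ ∫ ω, ψ (Y ω) ∂P

/-! ### Histories and history-dependent policies -/

/-- Histories `(x₀, a₀, x₁, a₁, …, xₙ)` up to time `n`. There are no constraints on the actions,
so all of them are feasible. -/
def Hist (S A : Type) : ℕ → Type
  | 0 => S
  | n + 1 => Hist S A n × A × S

instance Hist.measurableSpace (S A : Type) [mS : MeasurableSpace S] [mA : MeasurableSpace A] :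
    (n : ℕ) → MeasurableSpace (Hist S A n)
  | 0 => mS
  | n + 1 => @Prod.instMeasurableSpace _ _ (Hist.measurableSpace S A n) inferInstance

/-- The current state `xₙ` of a history. -/
def Hist.last {S A : Type} : {n : ℕ} → Hist S A n → S
  | 0, x => x
  | _ + 1, h => h.2.2

/-- Policies: sequences `(d₀, d₁, …)` of measurable decision rules `dₙ : Hₙ → A`. Under a horizon
`N` only `d₀, …, d_{N-1}` are ever used. -/
def Policy (S A : Type) [MeasurableSpace S] [MeasurableSpace A] : Type :=
  {d : (n : ℕ) → Hist S A n → A // ∀ n, Measurable (d n)}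

/-- The history of the decision process at time `n + j` when it is started at time `n` with the
history `h`, as a function of the scenario `ω`; `T k x a ω` is the state at time `k + 1` after
action `a` in state `x` at time `k`. -/
def histFrom {S A : Type} {Ω : Type*} (T : ℕ → S → A → Ω → S) (d : (n : ℕ) → Hist S A n → A)
    (n : ℕ) (h : Hist S A n) (ω : Ω) : (j : ℕ) → Hist S A (n + j)
  | 0 => h
  | j + 1 =>
    let h' := histFrom T d n h ω j
    (h', d (n + j) h', T (n + j) h'.last (d (n + j) h') ω)

/-! ### The dynamic reinsurance model -/

/-- The data of the model: the probability space, the aggregate claims `Y k` and the premium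
income `Z k` of the period from time `k` to time `k + 1`, the safety loading and the
discount factor. -/
structure Model (Ω : Type*) [MeasurableSpace Ω] where
  P : Measure Ω
  Y : ℕ → Ω → ℝ≥0
  Z : ℕ → Ω → ℝ
  θ : ℝ
  β : Set.Ioc (0 : ℝ) 1

/-- The extended state space `ℝ × ℝ₊ × (0, 1]`: surplus, accumulated cost, discounting. -/
abbrev ExtState : Type := ℝ × ℝ≥0 × Set.Ioc (0 : ℝ) 1

namespace Model

variable {Ω : Type*} [MeasurableSpace Ω] (M : Model Ω)

/-- The expected premium principle applied to the ceded loss, `(1 + θ) E[Y - f(Y)]`. -/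
noncomputable def premium (k : ℕ) (f : RetainedLoss) : ℝ :=
  (1 + M.θ) * ∫ ω, ((M.Y k ω : ℝ) - f (M.Y k ω)) ∂M.P

/-- The maximal premium income `ess sup Z`. -/
noncomputable def zhat (k : ℕ) : ℝ := essSup (M.Z k) M.P

/-- The one-stage cost `f(Y) + π_R(f) + ess sup Z - Z`. -/
noncomputable def cost (k : ℕ) (f : RetainedLoss) (ω : Ω) : ℝ :=
  f (M.Y k ω) + M.premium k f + M.zhat k - M.Z k ω

/-- The surplus at the end of the period, `x - f(Y) - π_R(f) + Z`. -/
noncomputable def next (k : ℕ) (x : ℝ) (f : RetainedLoss) (ω : Ω) : ℝ :=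
  x - f (M.Y k ω) - M.premium k f + M.Z k ω

/-- The transition function on the extended state space. Since `Z ≤ ess sup Z` almost surely, the
new accumulated cost is nonnegative almost surely, and `Real.toNNReal` changes it on a
null set only. -/
noncomputable def extNext (k : ℕ) (e : ExtState) (f : RetainedLoss) (ω : Ω) : ExtState :=
  (M.next k e.1 f ω, Real.toNNReal (e.2.1 + e.2.2 * M.cost k f ω), M.β * e.2.2)

/-- `∑_{j < m} β^j · (one-stage cost of the period starting at time n + j)` under the policy `d`,
if the process with transition function `T` is started at time `n` with the history `h`. -/
noncomputable def discountedCost {S : Type} (T : ℕ → S → RetainedLoss → Ω → S)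
    (d : (n : ℕ) → Hist S RetainedLoss n → RetainedLoss) (n : ℕ) (h : Hist S RetainedLoss n)
    (m : ℕ) (ω : Ω) : ℝ :=
  ∑ j ∈ Finset.range m,
    (M.β : ℝ) ^ j * M.cost (n + j) (d (n + j) (histFrom T d n h ω j)) ω

/-! #### The inner problem -/

/-- `E[g(C)]` for the total discounted cost `C` of the policy `π` over `N` periods, if the initial
surplus is `x`. -/
noncomputable def innerValue (g : ℝ → ℝ) (N : ℕ) (π : Policy ℝ RetainedLoss) (x : ℝ) : ℝ :=
  ∫ ω, g (M.discountedCost M.next π.1 0 x N ω) ∂M.P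

/-- The optimal value of the inner problem. -/
noncomputable def innerOpt (g : ℝ → ℝ) (N : ℕ) (x : ℝ) : ℝ :=
  ⨅ π : Policy ℝ RetainedLoss, M.innerValue g N π x

/-! #### The problem on the extended state space -/

/-- `V_{nπ}(hₙ)`: the conditional expectation, given the history `h` at time `n`, of
`g(sₙ + tₙ · remaining discounted cost)`. -/
noncomputable def policyValue (g : ℝ → ℝ) (N : ℕ) (π : Policy ExtState RetainedLoss) (n : ℕ)
    (h : Hist ExtState RetainedLoss n) : ℝ :=
  ∫ ω, g (h.last.2.1 + h.last.2.2 * M.discountedCost M.extNext π.1 n h (N - n) ω) ∂M.P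

/-- The value function `V_n(hₙ)` over all history-dependent policies. -/
noncomputable def valueV (g : ℝ → ℝ) (N : ℕ) (n : ℕ) (h : Hist ExtState RetainedLoss n) : ℝ :=
  ⨅ π : Policy ExtState RetainedLoss, M.policyValue g N π n h

/-- The operator `L_n v(x, s, t, f) = E[v(extended state at time n + 1)]`. -/
noncomputable def opL (n : ℕ) (v : ExtState → ℝ) (e : ExtState) (f : RetainedLoss) : ℝ :=
  ∫ ω, v (M.extNext n e f ω) ∂M.P

/-- The value of a Markov policy `d` from time `n` on when `m` periods remain. -/
noncomputable def markovValueAux (g : ℝ → ℝ) (d : ℕ → ExtState → RetainedLoss) :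
    (m n : ℕ) → ExtState → ℝ
  | 0, _, e => g e.2.1
  | m + 1, n, e => M.opL n (markovValueAux g d m (n + 1)) e (d n e)

/-- The Markov value function `J_n(x, s, t)`: the infimum over all Markov policies, i.e. over all
sequences of measurable decision rules depending on the current extended state only. -/
noncomputable def valueJ (g : ℝ → ℝ) (N : ℕ) (n : ℕ) (e : ExtState) : ℝ :=
  ⨅ d : {d : ℕ → ExtState → RetainedLoss // ∀ k, Measurable (d k)},
    M.markovValueAux g d.1 (N - n) n e

/-- The extended state belonging to a history of the original model: it starts in `(x₀, 0, 1)` and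
adds up the discounted one-stage costs `x - x' + ess sup Z`. -/
noncomputable def toExt : {n : ℕ} → Hist ℝ RetainedLoss n → ExtState
  | 0, x => (x, 0, ⟨1, by norm_num⟩)
  | n + 1, h =>
    let e := toExt h.1
    (h.2.2, Real.toNNReal (e.2.1 + e.2.2 * (h.1.last - h.2.2 + M.zhat n)), M.β * e.2.2)

end Model

/-- The class of disutility functions: increasing convex functions `g : ℝ → ℝ` which are
`L`-Lipschitz and satisfy `0 ≤ g(x) ≤ L x⁺ + r`. For a bounded spectrum `φ` one has `L = φ(1)`. -/
def IsDisutility (L : ℝ≥0) (r : ℝ) (g : ℝ → ℝ) : Prop :=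
  Monotone g ∧ ConvexOn ℝ Set.univ g ∧ LipschitzWith L g ∧ ∀ x, 0 ≤ g x ∧ g x ≤ L * max x 0 + r

end Reinsurance

namespace Reinsurance

/-! ### The action space -/

instance : SecondCountableTopology RetainedLoss :=
  TopologicalSpace.Subtype.secondCountableTopology {f : C(ℝ≥0, ℝ≥0) | IsRetainedLoss f}

namespace RetainedLoss

theorem apply_le (f : RetainedLoss) (t : ℝ≥0) : f t ≤ t := f.2.1 t

theorem continuous_apply (f : RetainedLoss) : Continuous f := f.1.continuous

theorem continuous_uncurry : Continuous fun p : RetainedLoss × ℝ≥0 => p.1 p.2 := by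
  have h : Continuous fun p : C(ℝ≥0, ℝ≥0) × ℝ≥0 => p.1 p.2 := continuous_eval
  exact h.comp ((continuous_subtype_val.comp continuous_fst).prodMk continuous_snd)

theorem measurable_uncurry : Measurable fun p : RetainedLoss × ℝ≥0 => p.1 p.2 :=
  continuous_uncurry.measurable

/-- The set of retained loss functions is convex. -/
theorem exists_convexComb (f₁ f₂ : RetainedLoss) {a b : ℝ} (ha : 0 ≤ a) (hb : 0 ≤ b)
    (hab : a + b = 1) :
    ∃ f : RetainedLoss, ∀ t : ℝ≥0, (f t : ℝ) = a * f₁ t + b * f₂ t := by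
  lift a to ℝ≥0 using ha
  lift b to ℝ≥0 using hb
  have hab' : a + b = 1 := by exact_mod_cast hab
  have h : IsRetainedLoss fun t => a * f₁ t + b * f₂ t := by
    have hle : ∀ t, a * f₁ t + b * f₂ t ≤ t := fun t => calc
      a * f₁ t + b * f₂ t ≤ a * t + b * t := by
        gcongr
        · exact f₁.apply_le t
        · exact f₂.apply_le t
      _ = t := by rw [← add_mul, hab', one_mul]
    refine ⟨hle, fun x y hxy => ?_, fun x y hxy => ?_⟩
    · have h₁ := f₁.2.2.1 hxy
      have h₂ := f₂.2.2.1 hxy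
      dsimp only
      gcongr
    · have e : ∀ t, t - (a * f₁ t + b * f₂ t) = a * (t - f₁ t) + b * (t - f₂ t) := fun t => by
        rw [← NNReal.coe_inj]
        push_cast [NNReal.coe_sub (hle t), NNReal.coe_sub (f₁.apply_le t),
          NNReal.coe_sub (f₂.apply_le t)]
        linear_combination (-(t : ℝ)) * hab
      have h₁ := f₁.2.2.2 hxy
      have h₂ := f₂.2.2.2 hxy
      dsimp only at h₁ h₂ ⊢
      rw [e, e]
      exact add_le_add (mul_le_mul_right h₁ a) (mul_le_mul_right h₂ b)
  exact ⟨⟨⟨_, h.lipschitz.continuous⟩, h⟩, fun t => by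
    change ((a * f₁ t + b * f₂ t : ℝ≥0) : ℝ) = _
    push_cast
    rfl⟩

end RetainedLoss

theorem continuous_stopLossFun_uncurry :
    Continuous fun p : ℝ≥0∞ × ℝ≥0 => stopLossFun p.1 p.2 := by
  refine ENNReal.continuousOn_toNNReal.comp_continuous
    ((ENNReal.continuous_coe.comp continuous_snd).min continuous_fst) fun p => ?_
  exact ne_top_of_le_ne_top ENNReal.coe_ne_top (min_le_left _ _)

theorem continuous_stopLoss : Continuous stopLoss :=
  (ContinuousMap.continuous_of_continuous_uncurry _ continuous_stopLossFun_uncurry).subtype_mk _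

theorem stopLoss_coe_apply (a x : ℝ≥0) : stopLoss a x = min x a := by
  change stopLossFun a x = _
  rw [← ENNReal.coe_inj, coe_stopLossFun, ENNReal.coe_min]

theorem stopLoss_top_apply (x : ℝ≥0) : stopLoss ∞ x = x := by
  change stopLossFun ∞ x = _
  rw [← ENNReal.coe_inj, coe_stopLossFun, min_eq_left le_top]

theorem stopLoss_zero_apply (x : ℝ≥0) : stopLoss 0 x = 0 := by
  change stopLossFun 0 x = _
  rw [← ENNReal.coe_inj, coe_stopLossFun, min_eq_right zero_le, ENNReal.coe_zero]

/-! ### Convex order and stop-loss treaties -/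

/-- A subgradient of `ψ` at `a`, which also bounds all the slopes on the left of `a`. -/
theorem exists_slope_of_convexOn {ψ : ℝ → ℝ} (hψ : ConvexOn ℝ Set.univ ψ) (a : ℝ) :
    ∃ c, (∀ v, a ≤ v → c * (v - a) ≤ ψ v - ψ a) ∧
      ∀ u w, u ≤ w → w ≤ a → ψ w - ψ u ≤ c * (w - u) := by
  have mono : ∀ u w v, u < w → w ≤ a → a < v →
      (ψ w - ψ u) / (w - u) ≤ (ψ v - ψ a) / (v - a) := by
    intro u w v huw hwa hav
    rcases hwa.eq_or_lt with rfl | hwa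
    · exact hψ.slope_mono_adjacent trivial trivial huw hav
    · exact (hψ.slope_mono_adjacent trivial trivial huw hwa).trans
        (hψ.slope_mono_adjacent trivial trivial hwa hav)
  let A : Set ℝ := (fun v => (ψ v - ψ a) / (v - a)) '' Set.Ioi a
  have hne : A.Nonempty := ⟨_, a + 1, by simp, rfl⟩
  have hlb : ∀ u w, u < w → w ≤ a → (ψ w - ψ u) / (w - u) ∈ lowerBounds A := by
    rintro u w huw hwa _ ⟨v, hv, rfl⟩
    exact mono u w v huw hwa hv
  refine ⟨sInf A, fun v hv => ?_, fun u w huw hwa => ?_⟩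
  · rcases hv.eq_or_lt with rfl | hv
    · simp
    · have h : sInf A ≤ (ψ v - ψ a) / (v - a) :=
        csInf_le ⟨_, hlb (a - 1) a (by linarith) le_rfl⟩ ⟨v, hv, rfl⟩
      rwa [le_div_iff₀ (by linarith)] at h
  · rcases huw.eq_or_lt with rfl | huw
    · simp
    · have h := le_csInf hne (hlb u w huw hwa)
      rwa [div_le_iff₀ (by linarith)] at h

section

variable {Ω : Type*} [MeasurableSpace Ω] {P : Measure Ω} {Y : Ω → ℝ≥0}

theorem RetainedLoss.measurable_comp (f : RetainedLoss) (hYm : Measurable Y) :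
    Measurable fun ω => (f (Y ω) : ℝ) :=
  (f.continuous_apply.measurable.comp hYm).coe_nnreal_real

theorem RetainedLoss.integrable_comp (f : RetainedLoss) (hYm : Measurable Y)
    (hY : Integrable (fun ω => (Y ω : ℝ)) P) : Integrable (fun ω => (f (Y ω) : ℝ)) P :=
  hY.mono' (f.measurable_comp hYm).aestronglyMeasurable <| .of_forall fun ω => by
    rw [Real.norm_of_nonneg NNReal.zero_le_coe]
    exact_mod_cast f.apply_le (Y ω)

theorem continuous_integral_stopLoss (hYm : Measurable Y)
    (hY : Integrable (fun ω => (Y ω : ℝ)) P) :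
    Continuous fun a => ∫ ω, (stopLoss a (Y ω) : ℝ) ∂P := by
  refine continuous_of_dominated
    (fun a => ((stopLoss a).measurable_comp hYm).aestronglyMeasurable)
    (fun a => .of_forall fun ω => ?_) hY (.of_forall fun ω => ?_)
  · rw [Real.norm_of_nonneg NNReal.zero_le_coe]
    exact_mod_cast (stopLoss a).apply_le (Y ω)
  · exact NNReal.continuous_coe.comp
      (continuous_stopLossFun_uncurry.comp (continuous_id.prodMk continuous_const))

theorem convexOrder_stopLoss_of_integral_eq [IsProbabilityMeasure P] (hYm : Measurable Y)
    (hY : Integrable (fun ω => (Y ω : ℝ)) P) (f : RetainedLoss) (a : ℝ≥0)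
    (h : ∫ ω, (stopLoss a (Y ω) : ℝ) ∂P = ∫ ω, (f (Y ω) : ℝ) ∂P) :
    ConvexOrder P (fun ω => (stopLoss a (Y ω) : ℝ)) (fun ω => (f (Y ω) : ℝ)) := by
  have hs := (stopLoss a).integrable_comp hYm hY
  have hf := f.integrable_comp hYm hY
  refine ⟨hs, hf, fun ψ hψ hint => ?_⟩
  have hcont : Continuous ψ := by
    simpa [continuousOn_univ] using hψ.continuousOn isOpen_univ
  have hint' : Integrable (fun ω => ψ (stopLoss a (Y ω))) P := by
    obtain ⟨C, hC⟩ := (isCompact_Icc (a := (0 : ℝ)) (b := a)).exists_bound_of_continuousOn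
      hcont.continuousOn
    refine Integrable.of_bound
      (hcont.measurable.comp ((stopLoss a).measurable_comp hYm)).aestronglyMeasurable C
      (.of_forall fun ω => hC _ ⟨NNReal.zero_le_coe, ?_⟩)
    rw [stopLoss_coe_apply]
    exact_mod_cast min_le_right _ _
  refine ⟨hint', ?_⟩
  obtain ⟨c, hc₁, hc₂⟩ := exists_slope_of_convexOn hψ a
  have key : ∀ ω, c * ((f (Y ω) : ℝ) - stopLoss a (Y ω)) ≤
      ψ (f (Y ω)) - ψ (stopLoss a (Y ω)) := by
    intro ω
    have hfY := f.apply_le (Y ω)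
    rw [stopLoss_coe_apply]
    rcases le_total a (f (Y ω)) with hle | hle
    · rw [min_eq_right (hle.trans hfY)]
      exact hc₁ _ (by exact_mod_cast hle)
    · have := hc₂ (f (Y ω)) (min (Y ω) a : ℝ≥0) (by exact_mod_cast le_min hfY hle)
        (by exact_mod_cast min_le_right _ _)
      linarith
  have := integral_mono ((hf.sub hs).const_mul c) (hint.sub hint') key
  simp only [Pi.sub_apply] at this
  rw [integral_const_mul, integral_sub hf hs, integral_sub hint hint', h] at this
  linarith

theorem exists_convexOrder_stopLoss [IsProbabilityMeasure P] (hYm : Measurable Y)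
    (hY : Integrable (fun ω => (Y ω : ℝ)) P) (f : RetainedLoss) :
    ∃ a : ℝ≥0∞, ConvexOrder P (fun ω => (stopLoss a (Y ω) : ℝ)) (fun ω => (f (Y ω) : ℝ)) := by
  have hf := f.integrable_comp hYm hY
  have hmem : ∫ ω, (f (Y ω) : ℝ) ∂P ∈ Set.Icc (∫ ω, (stopLoss 0 (Y ω) : ℝ) ∂P)
      (∫ ω, (stopLoss ∞ (Y ω) : ℝ) ∂P) := by
    constructor
    · simp only [stopLoss_zero_apply, NNReal.coe_zero, integral_zero]
      exact integral_nonneg fun ω => NNReal.zero_le_coe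
    · simp only [stopLoss_top_apply]
      exact integral_mono hf hY fun ω => NNReal.coe_le_coe.2 (f.apply_le (Y ω))
  obtain ⟨a, ha⟩ := intermediate_value_univ _ _ (continuous_integral_stopLoss hYm hY) hmem
  refine ⟨a, ?_⟩
  induction a with
  | coe a => exact convexOrder_stopLoss_of_integral_eq hYm hY f a ha
  | top =>
    simp only [stopLoss_top_apply] at ha ⊢
    have hae : (fun ω => (Y ω : ℝ)) =ᵐ[P] fun ω => (f (Y ω) : ℝ) := by
      have h0 : ∫ ω, ((Y ω : ℝ) - f (Y ω)) ∂P = 0 := by rw [integral_sub hY hf]; linarith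
      rw [integral_eq_zero_iff_of_nonneg
        (fun ω => sub_nonneg.2 (NNReal.coe_le_coe.2 (f.apply_le (Y ω)))) (hY.sub hf)] at h0
      filter_upwards [h0] with ω hω
      simpa [sub_eq_zero] using hω
    refine ⟨hY, hf, fun ψ _ hint => ?_⟩
    have h' : (fun ω => ψ (Y ω)) =ᵐ[P] fun ω => ψ (f (Y ω)) := by
      filter_upwards [hae] with ω hω
      rw [hω]
    exact ⟨hint.congr h'.symm, (integral_congr_ae h').le⟩

theorem ConvexOrder.integral_eq {X X' : Ω → ℝ} (h : ConvexOrder P X X') :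
    ∫ ω, X ω ∂P = ∫ ω, X' ω ∂P := by
  have h₁ := (h.2.2 id (convexOn_id convex_univ) h.2.1).2
  have h₂ := (h.2.2 (fun x => -x) (concaveOn_id convex_univ).neg h.2.1.neg).2
  rw [integral_neg, integral_neg] at h₂
  exact le_antisymm h₁ (neg_le_neg_iff.1 h₂)

end

/-! ### Independence and measurable selection -/

/-- Fubini's theorem for a function of two independent random variables. -/
theorem integral_comp_of_indepFun {Ω α γ : Type*} [MeasurableSpace Ω] [MeasurableSpace α]
    [MeasurableSpace γ] {P : Measure Ω} [IsProbabilityMeasure P] {U : Ω → α} {V : Ω → γ}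
    (hU : Measurable U) (hV : Measurable V) (hUV : IndepFun U V P) {Φ : α × γ → ℝ}
    (hΦ : Measurable Φ) (hint : Integrable (fun ω => Φ (U ω, V ω)) P) :
    Integrable (fun ω => ∫ ω', Φ (U ω, V ω') ∂P) P ∧
      ∫ ω, Φ (U ω, V ω) ∂P = ∫ ω, ∫ ω', Φ (U ω, V ω') ∂P ∂P := by
  have hmap := (indepFun_iff_map_prod_eq_prod_map_map hU.aemeasurable hV.aemeasurable).1 hUV
  have := Measure.isProbabilityMeasure_map (μ := P) hU.aemeasurable
  have := Measure.isProbabilityMeasure_map (μ := P) hV.aemeasurable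
  have hint' : Integrable Φ ((P.map U).prod (P.map V)) := by
    rw [← hmap]
    exact (integrable_map_measure hΦ.aestronglyMeasurable (hU.prodMk hV).aemeasurable).2 hint
  have hinner : ∀ u, ∫ y, Φ (u, y) ∂(P.map V) = ∫ ω', Φ (u, V ω') ∂P := fun u =>
    integral_map hV.aemeasurable (hΦ.comp measurable_prodMk_left).aestronglyMeasurable
  have hleft := hint'.integral_prod_left
  simp only [hinner] at hleft
  refine ⟨(integrable_map_measure hleft.aestronglyMeasurable hU.aemeasurable).1 hleft, ?_⟩
  calc ∫ ω, Φ (U ω, V ω) ∂P = ∫ p, Φ p ∂((P.map U).prod (P.map V)) := by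
        rw [← hmap, integral_map (hU.prodMk hV).aemeasurable hΦ.aestronglyMeasurable]
    _ = ∫ u, ∫ ω', Φ (u, V ω') ∂P ∂(P.map U) := by
        rw [integral_prod _ hint']
        simp only [hinner]
    _ = _ := integral_map hU.aemeasurable hleft.aestronglyMeasurable

/-- The least minimizer of a family of continuous functions on `[0, ∞]` which depends measurably
on a parameter is a measurable function of the parameter. -/
theorem exists_measurable_argmin {E : Type*} [MeasurableSpace E] {G : E → ℝ≥0∞ → ℝ}
    (hG : ∀ e, Continuous (G e)) (hGm : ∀ a, Measurable fun e => G e a) :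
    ∃ sel : E → ℝ≥0∞, Measurable sel ∧ ∀ e a, G e (sel e) ≤ G e a := by
  let D := TopologicalSpace.denseSeq ℝ≥0∞
  let A : E → Set ℝ≥0∞ := fun e => {a | ∀ b, G e a ≤ G e b}
  have hA : ∀ e, (A e).Nonempty := fun e => by
    obtain ⟨a, -, ha⟩ := isCompact_univ.exists_isMinOn (Set.univ_nonempty (α := ℝ≥0∞))
      (hG e).continuousOn
    exact ⟨a, fun b => ha (Set.mem_univ b)⟩
  have hsel : ∀ e, sInf (A e) ∈ A e := fun e => by
    refine IsClosed.sInf_mem (hA e) ?_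
    simp only [A, Set.ofPred_forall]
    exact isClosed_iInter fun b => isClosed_le (hG e) continuous_const
  have hmin : ∀ e q, Continuous fun a => G e (min a q) := fun e q =>
    (hG e).comp (continuous_id.min continuous_const)
  have hbdd : ∀ e q, BddBelow (Set.range fun i => G e (min (D i) q)) := fun e q =>
    ((isCompact_range (hG e)).bddBelow).mono <| by
      rintro _ ⟨i, rfl⟩
      exact ⟨_, rfl⟩
  have hle : ∀ e q a, ⨅ i, G e (min (D i) q) ≤ G e (min a q) := fun e q a => by
    have hcl : IsClosed {a | ⨅ i, G e (min (D i) q) ≤ G e (min a q)} :=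
      isClosed_le continuous_const (hmin e q)
    have hD : Set.range D ⊆ {a | ⨅ i, G e (min (D i) q) ≤ G e (min a q)} := by
      rintro _ ⟨i, rfl⟩
      exact ciInf_le (hbdd e q) i
    exact hcl.closure_subset_iff.2 hD (TopologicalSpace.denseRange_denseSeq ℝ≥0∞ a)
  refine ⟨fun e => sInf (A e), measurable_of_Iic fun q => ?_, fun e a => hsel e a⟩
  have heq : (fun e => sInf (A e)) ⁻¹' Set.Iic q =
      {e | ⨅ i, G e (min (D i) q) ≤ ⨅ i, G e (min (D i) ∞)} := by
    ext e
    simp only [Set.mem_preimage, Set.mem_Iic, Set.mem_ofPred_eq]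
    constructor
    · intro h
      refine le_ciInf fun i => (hle e q (sInf (A e))).trans ?_
      rw [min_eq_left h]
      exact hsel e _
    · intro h
      obtain ⟨a, -, ha⟩ := isCompact_univ.exists_isMinOn (Set.univ_nonempty (α := ℝ≥0∞))
        (hmin e q).continuousOn
      have hmem : min a q ∈ A e := fun b => calc
        G e (min a q) ≤ ⨅ i, G e (min (D i) q) := le_ciInf fun i => ha (Set.mem_univ (D i))
        _ ≤ ⨅ i, G e (min (D i) ∞) := h
        _ ≤ G e (min b ∞) := hle e ∞ b
        _ = G e b := by rw [min_eq_left le_top]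
      exact (sInf_le hmem).trans (min_le_right _ _)
  rw [heq]
  exact measurableSet_le (Measurable.iInf fun i => hGm _) (Measurable.iInf fun i => hGm _)

/-! ### One-stage costs -/

namespace Model

variable {Ω : Type*} [MeasurableSpace Ω]

/-- The standing assumptions on the model. -/
structure IsAdmissible (M : Model Ω) : Prop where
  measurable_Y : ∀ k, Measurable (M.Y k)
  integrable_Y : ∀ k, Integrable (fun ω => (M.Y k ω : ℝ)) M.P
  measurable_Z : ∀ k, Measurable (M.Z k)
  memLp_Z : ∀ k, MemLp (M.Z k) ∞ M.P
  indep : iIndepFun (fun k ω => (M.Y k ω, M.Z k ω)) M.P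
  indep_YZ : ∀ k, IndepFun (M.Y k) (M.Z k) M.P
  θ_pos : 0 < M.θ

/-- The disturbance of the period from time `k` to time `k + 1`. -/
def noise (M : Model Ω) (k : ℕ) (ω : Ω) : ℝ≥0 × ℝ := (M.Y k ω, M.Z k ω)

/-- The one-stage cost as a function of the treaty and the disturbance. -/
noncomputable def costFun (M : Model Ω) (k : ℕ) (p : RetainedLoss × ℝ≥0 × ℝ) : ℝ :=
  p.1 p.2.1 + M.premium k p.1 + M.zhat k - p.2.2

theorem cost_eq_costFun (M : Model Ω) (k : ℕ) (f : RetainedLoss) (ω : Ω) :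
    M.cost k f ω = M.costFun k (f, M.noise k ω) := rfl

/-- An integrable bound of the one-stage cost, uniformly in the treaty. -/
noncomputable def costBound (M : Model Ω) (k : ℕ) (ω : Ω) : ℝ :=
  M.Y k ω + (1 + M.θ) * ∫ ω, (M.Y k ω : ℝ) ∂M.P + |M.zhat k| + |M.Z k ω|

variable {M : Model Ω}

namespace IsAdmissible

variable (hM : M.IsAdmissible)
include hM

theorem integrable_retained (k : ℕ) (f : RetainedLoss) :
    Integrable (fun ω => (f (M.Y k ω) : ℝ)) M.P :=
  f.integrable_comp (hM.measurable_Y k) (hM.integrable_Y k)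

theorem measurable_noise (k : ℕ) : Measurable (M.noise k) :=
  (hM.measurable_Y k).prodMk (hM.measurable_Z k)

theorem premium_nonneg (k : ℕ) (f : RetainedLoss) : 0 ≤ M.premium k f :=
  mul_nonneg (by linarith [hM.θ_pos]) <|
    integral_nonneg fun ω => sub_nonneg.2 (NNReal.coe_le_coe.2 (f.apply_le _))

theorem premium_eq (k : ℕ) (f : RetainedLoss) :
    M.premium k f =
      (1 + M.θ) * (∫ ω, (M.Y k ω : ℝ) ∂M.P - ∫ ω, (f (M.Y k ω) : ℝ) ∂M.P) := by
  rw [premium, integral_sub (hM.integrable_Y k) (hM.integrable_retained k f)]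

theorem premium_le (k : ℕ) (f : RetainedLoss) :
    M.premium k f ≤ (1 + M.θ) * ∫ ω, (M.Y k ω : ℝ) ∂M.P := by
  rw [hM.premium_eq]
  have : 0 ≤ ∫ ω, (f (M.Y k ω) : ℝ) ∂M.P := integral_nonneg fun ω => NNReal.zero_le_coe
  have := hM.θ_pos
  gcongr
  linarith

theorem abs_cost_le (k : ℕ) (f : RetainedLoss) (ω : Ω) : |M.cost k f ω| ≤ M.costBound k ω := by
  have h₁ : (f (M.Y k ω) : ℝ) ≤ M.Y k ω := NNReal.coe_le_coe.2 (f.apply_le _)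
  have h₂ : (0 : ℝ) ≤ f (M.Y k ω) := NNReal.zero_le_coe
  have h₃ := hM.premium_nonneg k f
  have h₄ := hM.premium_le k f
  have h₅ := abs_le.1 (le_refl |M.zhat k|)
  have h₆ := abs_le.1 (le_refl |M.Z k ω|)
  rw [abs_le, cost, costBound]
  constructor <;> linarith [h₅.1, h₅.2, h₆.1, h₆.2]

/-- Almost surely, all the one-stage costs are nonnegative. -/
theorem ae_cost_nonneg : ∀ᵐ ω ∂M.P, ∀ k f, 0 ≤ M.cost k f ω := by
  rw [ae_all_iff]
  intro k
  have hbdd : Filter.IsBoundedUnder (· ≤ ·) (ae M.P) (M.Z k) := by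
    obtain ⟨C, hC⟩ : ∃ C : ℝ, ∀ᵐ ω ∂M.P, ‖M.Z k ω‖ ≤ C := by
      refine ⟨(eLpNormEssSup (M.Z k) M.P).toReal, ?_⟩
      have hfin : eLpNormEssSup (M.Z k) M.P < ∞ := by
        simpa using (hM.memLp_Z k).2
      filter_upwards [enorm_ae_le_eLpNormEssSup (M.Z k) M.P] with ω hω
      rw [← toReal_enorm]
      exact ENNReal.toReal_mono hfin.ne hω
    exact ⟨C, by
      rw [Filter.eventually_map]
      filter_upwards [hC] with ω hω using (le_abs_self _).trans hω⟩
  filter_upwards [ae_le_essSup hbdd] with ω hω f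
  have h₂ : (0 : ℝ) ≤ f (M.Y k ω) := NNReal.zero_le_coe
  have h₃ := hM.premium_nonneg k f
  have h₄ : M.Z k ω ≤ M.zhat k := hω
  rw [cost]
  linarith

variable [IsProbabilityMeasure M.P]

theorem integrable_Z (k : ℕ) : Integrable (M.Z k) M.P :=
  (hM.memLp_Z k).integrable le_top

theorem measurable_premium (k : ℕ) : Measurable (M.premium k) := by
  have h : Measurable fun p : RetainedLoss × Ω => ((M.Y k p.2 : ℝ) - p.1 (M.Y k p.2)) := by
    have h₁ : Measurable fun p : RetainedLoss × Ω => M.Y k p.2 :=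
      (hM.measurable_Y k).comp measurable_snd
    exact h₁.coe_nnreal_real.sub
      (RetainedLoss.measurable_uncurry.comp (measurable_fst.prodMk h₁)).coe_nnreal_real
  exact (StronglyMeasurable.integral_prod_right (ν := M.P)
    (f := fun (f : RetainedLoss) ω => ((M.Y k ω : ℝ) - f (M.Y k ω)))
    h.stronglyMeasurable).measurable.const_mul _

theorem measurable_costFun (k : ℕ) : Measurable (M.costFun k) := by
  have h₁ : Measurable fun p : RetainedLoss × ℝ≥0 × ℝ => (p.1 p.2.1 : ℝ) :=
    (RetainedLoss.measurable_uncurry.comp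
      (measurable_fst.prodMk (measurable_fst.comp measurable_snd))).coe_nnreal_real
  exact ((h₁.add ((hM.measurable_premium k).comp measurable_fst)).add_const _).sub
    (measurable_snd.comp measurable_snd)

theorem measurable_cost (k : ℕ) {F : Ω → RetainedLoss} (hF : Measurable F) :
    Measurable fun ω => M.cost k (F ω) ω :=
  (hM.measurable_costFun k).comp (hF.prodMk (hM.measurable_noise k))

theorem integrable_costBound (k : ℕ) : Integrable (M.costBound k) M.P :=
  (((hM.integrable_Y k).add (integrable_const _)).add (integrable_const _)).add
    (hM.integrable_Z k).abs

theorem integrable_cost (k : ℕ) {F : Ω → RetainedLoss} (hF : Measurable F) :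
    Integrable (fun ω => M.cost k (F ω) ω) M.P :=
  (hM.integrable_costBound k).mono' (hM.measurable_cost k hF).aestronglyMeasurable
    (.of_forall fun ω => hM.abs_cost_le k (F ω) ω)

end IsAdmissible

end Model

/-! ### Regular value functions -/

/-- Functions of the accumulated cost `s` and the discount factor `t` which are nonnegative, convex
in `s`, and Lipschitz with constants `L` in `s` and `K` in `t`. -/
structure IsRegular (L K : ℝ≥0) (v : ℝ → ℝ → ℝ) : Prop where
  nonneg : ∀ s t, 0 ≤ v s t
  convexOn : ∀ t, ConvexOn ℝ Set.univ fun s => v s t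
  sub_le : ∀ s t s' t', v s t - v s' t' ≤ L * |s - s'| + K * |t - t'|

theorem IsRegular.of_isDisutility {L : ℝ≥0} {r : ℝ} {g : ℝ → ℝ} (hg : IsDisutility L r g) :
    IsRegular L 0 fun s _ => g s where
  nonneg s _ := (hg.2.2.2 s).1
  convexOn _ := hg.2.1
  sub_le s t s' t' := by
    have := hg.2.2.1.dist_le_mul s s'
    rw [Real.dist_eq, Real.dist_eq] at this
    simpa using (le_abs_self _).trans this

namespace IsRegular

variable {L K : ℝ≥0} {v : ℝ → ℝ → ℝ} (hv : IsRegular L K v)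
include hv

theorem continuous_uncurry : Continuous fun p : ℝ × ℝ => v p.1 p.2 := by
  refine (LipschitzWith.of_dist_le_mul (K := L + K) fun p q => ?_).continuous
  have h₁ := hv.sub_le p.1 p.2 q.1 q.2
  have h₂ := hv.sub_le q.1 q.2 p.1 p.2
  rw [abs_sub_comm q.1, abs_sub_comm q.2] at h₂
  have h₃ : |p.1 - q.1| ≤ dist p q := le_max_left _ _
  have h₄ : |p.2 - q.2| ≤ dist p q := le_max_right _ _
  have h₅ : (L : ℝ) * |p.1 - q.1| + K * |p.2 - q.2| ≤ (L + K) * dist p q := by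
    rw [add_mul]
    gcongr
  rw [Real.dist_eq, abs_le]
  push_cast
  constructor <;> linarith

theorem continuous_left (t : ℝ) : Continuous fun s => v s t :=
  hv.continuous_uncurry.comp (continuous_id.prodMk continuous_const)

theorem le_add (s t : ℝ) : v s t ≤ v 0 0 + L * |s| + K * |t| := by
  have := hv.sub_le s t 0 0
  rw [sub_zero, sub_zero] at this
  linarith

theorem integrable_comp {Ω : Type*} [MeasurableSpace Ω] {P : Measure Ω} [IsFiniteMeasure P]
    {A : Ω → ℝ} (hA : Integrable A P) (t : ℝ) : Integrable (fun ω => v (A ω) t) P := by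
  refine (((integrable_const (v 0 0)).add (hA.abs.const_mul L)).add
    (integrable_const (K * |t|))).mono'
    ((hv.continuous_left t).comp_aestronglyMeasurable hA.1) (.of_forall fun ω => ?_)
  rw [Real.norm_of_nonneg (hv.nonneg _ _)]
  exact hv.le_add _ _

end IsRegular

namespace Model

variable {Ω : Type*} [MeasurableSpace Ω]

/-- The expected value `v` of the accumulated cost and the discount factor after one period under
the treaty `f`. -/
noncomputable def stepValue (M : Model Ω) (k : ℕ) (v : ℝ → ℝ → ℝ) (s t : ℝ) (f : RetainedLoss) :
    ℝ :=
  ∫ ω, v (s + t * M.cost k f ω) (M.β * t) ∂M.P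

/-- The optimal value over stop-loss treaties if `m` periods remain at time `n`, as a function of
the accumulated cost and the discount factor. -/
noncomputable def optValue (M : Model Ω) (g : ℝ → ℝ) : ℕ → ℕ → ℝ → ℝ → ℝ
  | 0, _, s, _ => g s
  | m + 1, n, s, t => ⨅ a : ℝ≥0∞, M.stepValue n (optValue M g m (n + 1)) s t (stopLoss a)

variable {M : Model Ω}

theorem stepValue_nonneg {L K : ℝ≥0} {v : ℝ → ℝ → ℝ} (hv : IsRegular L K v) (k : ℕ) (s t : ℝ) (f : RetainedLoss) : 0 ≤ M.stepValue k v s t f :=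
  integral_nonneg fun _ => hv.nonneg _ _

variable [IsProbabilityMeasure M.P]

namespace IsAdmissible

variable (hM : M.IsAdmissible)
include hM

theorem integrable_next_cost (k : ℕ) {A : Ω → ℝ} (hA : Integrable A M.P) (t : ℝ)
    {F : Ω → RetainedLoss} (hF : Measurable F) :
    Integrable (fun ω => A ω + t * M.cost k (F ω) ω) M.P :=
  hA.add ((hM.integrable_cost k hF).const_mul t)

variable {L K : ℝ≥0} {v : ℝ → ℝ → ℝ} (hv : IsRegular L K v)
include hv

theorem integrable_step (k : ℕ) (s t t' : ℝ) (f : RetainedLoss) :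
    Integrable (fun ω => v (s + t * M.cost k f ω) t') M.P :=
  hv.integrable_comp
    (hM.integrable_next_cost k (integrable_const s) t (F := fun _ => f) measurable_const) t'

theorem stepValue_sub_le (k : ℕ) (s t s' t' : ℝ) (f : RetainedLoss) :
    M.stepValue k v s t f - M.stepValue k v s' t' f ≤
      L * |s - s'| + (L * ∫ ω, M.costBound k ω ∂M.P + K) * |t - t'| := by
  have hB := hM.integrable_costBound k
  rw [stepValue, stepValue, ← integral_sub (hM.integrable_step hv k s t _ f)
    (hM.integrable_step hv k s' t' _ f)]
  have hB₁ : Integrable (fun ω => (L * M.costBound k ω + K) * |t - t'|) M.P :=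
    ((hB.const_mul _).add (integrable_const _)).mul_const _
  have hint : Integrable (fun ω => L * |s - s'| + (L * M.costBound k ω + K) * |t - t'|) M.P :=
    (integrable_const _).add hB₁
  refine (integral_mono ((hM.integrable_step hv k s t _ f).sub
    (hM.integrable_step hv k s' t' _ f)) hint fun ω => ?_).trans_eq ?_
  · refine (hv.sub_le _ _ _ _).trans ?_
    have h₁ : |s + t * M.cost k f ω - (s' + t' * M.cost k f ω)| ≤
        |s - s'| + |t - t'| * M.costBound k ω := calc
      _ = |(s - s') + (t - t') * M.cost k f ω| := by ring_nf
      _ ≤ |s - s'| + |t - t'| * |M.cost k f ω| := by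
        rw [← abs_mul]
        exact abs_add_le _ _
      _ ≤ _ := by
        gcongr
        exact hM.abs_cost_le k f ω
    have h₂ : |(M.β : ℝ) * t - M.β * t'| ≤ |t - t'| := by
      rw [← mul_sub, abs_mul, abs_of_pos M.β.2.1]
      exact mul_le_of_le_one_left (abs_nonneg _) M.β.2.2
    calc (L : ℝ) * |s + t * M.cost k f ω - (s' + t' * M.cost k f ω)| +
          K * |(M.β : ℝ) * t - M.β * t'|
        ≤ L * (|s - s'| + |t - t'| * M.costBound k ω) + K * |t - t'| := by gcongr
      _ = _ := by ring
  · rw [integral_add (integrable_const _) hB₁,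
      integral_const, integral_mul_const, integral_add (hB.const_mul _) (integrable_const _), integral_const_mul]
    simp

theorem continuous_stepValue_stopLoss (k : ℕ) (s t : ℝ) :
    Continuous fun a => M.stepValue k v s t (stopLoss a) := by
  have hprem : Continuous fun a => M.premium k (stopLoss a) := by
    simp only [hM.premium_eq]
    exact continuous_const.mul (continuous_const.sub
      (continuous_integral_stopLoss (hM.measurable_Y k) (hM.integrable_Y k)))
  refine continuous_of_dominated
    (bound := fun ω => v 0 0 + L * (|s| + |t| * M.costBound k ω) + K * |(M.β : ℝ) * t|)
    (fun a => (hM.integrable_step hv k s t _ _).1) (fun a => .of_forall fun ω => ?_) ?_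
    (.of_forall fun ω => ?_)
  · rw [Real.norm_of_nonneg (hv.nonneg _ _)]
    refine (hv.le_add _ _).trans ?_
    gcongr
    refine (abs_add_le _ _).trans ?_
    rw [abs_mul]
    gcongr
    exact hM.abs_cost_le k _ ω
  · exact ((integrable_const _).add (((integrable_const _).add
      ((hM.integrable_costBound k).const_mul _)).const_mul _)).add (integrable_const _)
  · refine (hv.continuous_left _).comp (continuous_const.add (continuous_const.mul ?_))
    have h : Continuous fun a => (stopLoss a (M.Y k ω) : ℝ) := NNReal.continuous_coe.comp
      (continuous_stopLossFun_uncurry.comp (continuous_id.prodMk continuous_const))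
    exact ((h.add hprem).add continuous_const).sub continuous_const

/-- A stop-loss treaty which retains less risk in the convex order is at least as good. -/
theorem stepValue_stopLoss_le (k : ℕ) (s t : ℝ) {f : RetainedLoss} {a : ℝ≥0∞}
    (h : ConvexOrder M.P (fun ω => (stopLoss a (M.Y k ω) : ℝ)) (fun ω => (f (M.Y k ω) : ℝ))) :
    M.stepValue k v s t (stopLoss a) ≤ M.stepValue k v s t f := by
  have hprem : M.premium k (stopLoss a) = M.premium k f := by
    rw [hM.premium_eq, hM.premium_eq, h.integral_eq]
  let Φ : ℝ × ℝ → ℝ := fun p =>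
    v (s + t * (p.1 + M.premium k f + M.zhat k - p.2)) (M.β * t)
  have hΦ : Continuous Φ := (hv.continuous_left _).comp (by fun_prop)
  let ψ : ℝ → ℝ := fun y => ∫ ω, Φ (y, M.Z k ω) ∂M.P
  have hintψ : ∀ y, Integrable (fun ω => Φ (y, M.Z k ω)) M.P := fun y =>
    hv.integrable_comp ((integrable_const s).add
      (((integrable_const (y + M.premium k f + M.zhat k)).sub (hM.integrable_Z k)).const_mul t)) _
  have hψ : ConvexOn ℝ Set.univ ψ := by
    refine ⟨convex_univ, fun x _ y _ b c hb hc hbc => ?_⟩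
    simp only [ψ, smul_eq_mul]
    rw [← integral_const_mul, ← integral_const_mul,
      ← integral_add ((hintψ x).const_mul b) ((hintψ y).const_mul c)]
    refine integral_mono (hintψ _) (((hintψ x).const_mul b).add ((hintψ y).const_mul c))
      fun ω => ?_
    refine le_trans (le_of_eq ?_) ((hv.convexOn (M.β * t)).2 (Set.mem_univ
      (s + t * (x + M.premium k f + M.zhat k - M.Z k ω))) (Set.mem_univ
      (s + t * (y + M.premium k f + M.zhat k - M.Z k ω))) hb hc hbc)
    simp only [Φ, smul_eq_mul]
    congr 1
    linear_combination (-(s + t * (M.premium k f + M.zhat k - M.Z k ω))) * hbc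
  have key : ∀ f' : RetainedLoss, M.premium k f' = M.premium k f →
      Integrable (fun ω => ψ (f' (M.Y k ω))) M.P ∧
        M.stepValue k v s t f' = ∫ ω, ψ (f' (M.Y k ω)) ∂M.P := by
    intro f' hf'
    have hmeas : Measurable fun y : ℝ≥0 => (f' y : ℝ) :=
      f'.continuous_apply.measurable.coe_nnreal_real
    have hint := hM.integrable_step hv k s t (M.β * t) f'
    simp only [cost, hf'] at hint
    have := integral_comp_of_indepFun ((hmeas).comp (hM.measurable_Y k)) (hM.measurable_Z k)
      ((hM.indep_YZ k).comp hmeas measurable_id) hΦ.measurable hint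
    refine ⟨this.1, ?_⟩
    rw [stepValue]
    simp only [cost, hf']
    exact this.2
  rw [(key _ hprem).2, (key f rfl).2]
  exact (h.2.2 ψ hψ (key f rfl).1).2

theorem exists_stepValue_stopLoss_le (k : ℕ) (s t : ℝ) (f : RetainedLoss) :
    ∃ a : ℝ≥0∞, M.stepValue k v s t (stopLoss a) ≤ M.stepValue k v s t f :=
  (exists_convexOrder_stopLoss (hM.measurable_Y k) (hM.integrable_Y k) f).imp
    fun _ => hM.stepValue_stopLoss_le hv k s t

theorem iInf_stepValue_le (k : ℕ) (s t : ℝ) (f : RetainedLoss) :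
    ⨅ a : ℝ≥0∞, M.stepValue k v s t (stopLoss a) ≤ M.stepValue k v s t f := by
  obtain ⟨a, ha⟩ := hM.exists_stepValue_stopLoss_le hv k s t f
  refine (ciInf_le ⟨0, ?_⟩ a).trans ha
  rintro _ ⟨a, rfl⟩
  exact stepValue_nonneg hv k s t _

theorem exists_stepValue_eq_iInf (k : ℕ) (s t : ℝ) :
    ∃ a : ℝ≥0∞, M.stepValue k v s t (stopLoss a) =
      ⨅ a : ℝ≥0∞, M.stepValue k v s t (stopLoss a) := by
  obtain ⟨a, -, ha⟩ := isCompact_univ.exists_isMinOn (Set.univ_nonempty (α := ℝ≥0∞))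
    (hM.continuous_stepValue_stopLoss hv k s t).continuousOn
  exact ⟨a, le_antisymm (le_ciInf fun b => ha (Set.mem_univ b)) (hM.iInf_stepValue_le hv k s t _)⟩

theorem exists_isRegular_iInf (k : ℕ) :
    ∃ K', IsRegular L K' fun s t => ⨅ a : ℝ≥0∞, M.stepValue k v s t (stopLoss a) := by
  have hC : 0 ≤ ∫ ω, M.costBound k ω ∂M.P := integral_nonneg fun ω =>
    (abs_nonneg _).trans (hM.abs_cost_le k (stopLoss 0) ω)
  refine ⟨L * (∫ ω, M.costBound k ω ∂M.P).toNNReal + K, fun s t => ?_, fun t => ?_,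
    fun s t s' t' => ?_⟩
  · exact le_ciInf fun a => stepValue_nonneg hv k s t _
  · refine ⟨convex_univ, fun s₁ _ s₂ _ b c hb hc hbc => ?_⟩
    obtain ⟨a₁, h₁⟩ := hM.exists_stepValue_eq_iInf hv k s₁ t
    obtain ⟨a₂, h₂⟩ := hM.exists_stepValue_eq_iInf hv k s₂ t
    obtain ⟨f, hf⟩ := (stopLoss a₁).exists_convexComb (stopLoss a₂) hb hc hbc
    dsimp only
    refine (hM.iInf_stepValue_le hv k _ t f).trans ?_
    simp only [← h₁, ← h₂, smul_eq_mul]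
    rw [stepValue, stepValue, stepValue, ← integral_const_mul, ← integral_const_mul]
    have i₁ := (hM.integrable_step hv k s₁ t (M.β * t) (stopLoss a₁)).const_mul b
    have i₂ := (hM.integrable_step hv k s₂ t (M.β * t) (stopLoss a₂)).const_mul c
    rw [← integral_add i₁ i₂]
    refine integral_mono (hM.integrable_step hv k _ t _ f) (i₁.add i₂) fun ω => ?_
    have hcost : M.cost k f ω =
        b * M.cost k (stopLoss a₁) ω + c * M.cost k (stopLoss a₂) ω := by
      have hprem : M.premium k f =
          b * M.premium k (stopLoss a₁) + c * M.premium k (stopLoss a₂) := by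
        have : ∫ ω, (f (M.Y k ω) : ℝ) ∂M.P = b * ∫ ω, (stopLoss a₁ (M.Y k ω) : ℝ) ∂M.P +
            c * ∫ ω, (stopLoss a₂ (M.Y k ω) : ℝ) ∂M.P := by
          simp only [hf]
          rw [integral_add ((hM.integrable_retained k _).const_mul b)
            ((hM.integrable_retained k _).const_mul c), integral_const_mul, integral_const_mul]
        rw [hM.premium_eq, hM.premium_eq, hM.premium_eq, this]
        linear_combination (-((1 + M.θ) * ∫ ω, (M.Y k ω : ℝ) ∂M.P)) * hbc
      rw [cost, cost, cost, hf, hprem]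
      linear_combination (M.Z k ω - M.zhat k) * hbc
    refine le_trans (le_of_eq ?_) ((hv.convexOn (M.β * t)).2 (Set.mem_univ
      (s₁ + t * M.cost k (stopLoss a₁) ω)) (Set.mem_univ
      (s₂ + t * M.cost k (stopLoss a₂) ω)) hb hc hbc)
    simp only [smul_eq_mul, hcost]
    ring_nf
  · obtain ⟨a, ha⟩ := hM.exists_stepValue_eq_iInf hv k s' t'
    have h₁ := hM.iInf_stepValue_le hv k s t (stopLoss a)
    have h₂ := hM.stepValue_sub_le hv k s t s' t' (stopLoss a)
    rw [← ha]
    push_cast [Real.coe_toNNReal _ hC]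
    linarith

omit hv

variable {r : ℝ} {g : ℝ → ℝ} (hg : IsDisutility L r g)
include hg

theorem exists_isRegular_optValue (m n : ℕ) : ∃ K, IsRegular L K (M.optValue g m n) := by
  induction m generalizing n with
  | zero => exact ⟨0, .of_isDisutility hg⟩
  | succ m ih =>
    obtain ⟨K, hK⟩ := ih (n + 1)
    exact hM.exists_isRegular_iInf hK n

theorem optValue_succ_le (m n : ℕ) (s t : ℝ) (f : RetainedLoss) :
    M.optValue g (m + 1) n s t ≤ M.stepValue n (M.optValue g m (n + 1)) s t f := by
  obtain ⟨K, hK⟩ := hM.exists_isRegular_optValue hg m (n + 1)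
  exact hM.iInf_stepValue_le hK n s t f

/-- Optimal stop-loss parameters can be chosen measurably. -/
theorem exists_measurable_stopLoss (m n : ℕ) :
    ∃ a : ExtState → ℝ≥0∞, Measurable a ∧ ∀ e : ExtState,
      M.stepValue n (M.optValue g m (n + 1)) e.2.1 e.2.2 (stopLoss (a e)) =
        M.optValue g (m + 1) n e.2.1 e.2.2 := by
  obtain ⟨K, hK⟩ := hM.exists_isRegular_optValue hg m (n + 1)
  have hmeas : ∀ a : ℝ≥0∞, Measurable fun e : ExtState =>
      M.stepValue n (M.optValue g m (n + 1)) e.2.1 e.2.2 (stopLoss a) := by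
    intro a
    have h₁ : Measurable fun p : ExtState × Ω =>
        M.optValue g m (n + 1) (p.1.2.1 + p.1.2.2 * M.cost n (stopLoss a) p.2)
          (M.β * p.1.2.2) := by
      have h₂ : Measurable fun p : ExtState × Ω => M.cost n (stopLoss a) p.2 :=
        (hM.measurable_cost n (F := fun _ => stopLoss a) measurable_const).comp measurable_snd
      have h₃ : Measurable fun p : ExtState × Ω =>
          ((p.1.2.1 + p.1.2.2 * M.cost n (stopLoss a) p.2, M.β * p.1.2.2) : ℝ × ℝ) := by
        fun_prop
      exact hK.continuous_uncurry.measurable.comp h₃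
    exact (StronglyMeasurable.integral_prod_right (ν := M.P) (f := fun (e : ExtState) ω =>
      M.optValue g m (n + 1) (e.2.1 + e.2.2 * M.cost n (stopLoss a) ω) (M.β * e.2.2))
      h₁.stronglyMeasurable).measurable
  obtain ⟨sel, hsel, hmin⟩ := exists_measurable_argmin
    (fun e : ExtState => hM.continuous_stepValue_stopLoss hK n e.2.1 e.2.2) hmeas
  exact ⟨sel, hsel, fun e => le_antisymm (le_ciInf fun a => hmin e a)
    (hM.optValue_succ_le hg m n _ _ _)⟩

end IsAdmissible

end Model

theorem Hist.measurable_last {S A : Type} [MeasurableSpace S] [MeasurableSpace A] :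
    ∀ n, Measurable (Hist.last : Hist S A n → S)
  | 0 => measurable_id
  | _ + 1 => measurable_snd.comp measurable_snd

namespace Model

variable {Ω : Type*} [MeasurableSpace Ω] {M : Model Ω}

/-! ### Controlled processes driven by the disturbances -/

/-- The information generated by the disturbances of the periods `n, …, m - 1`. -/
abbrev past (M : Model Ω) (n m : ℕ) : MeasurableSpace Ω :=
  ⨆ i ∈ Set.Ico n m, MeasurableSpace.comap (M.noise i) inferInstance

/-- The transition at time `k` depends measurably on the state, the action and the disturbance. -/
def IsNoiseDriven (M : Model Ω) {S : Type} [MeasurableSpace S]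
    (T : ℕ → S → RetainedLoss → Ω → S) : Prop :=
  ∀ k, ∃ τ : S × RetainedLoss × ℝ≥0 × ℝ → S,
    Measurable τ ∧ ∀ x f ω, T k x f ω = τ (x, f, M.noise k ω)

theorem past_mono (M : Model Ω) (n : ℕ) {m m' : ℕ} (h : m ≤ m') : M.past n m ≤ M.past n m' :=
  biSup_mono fun _ hi => ⟨hi.1, hi.2.trans_le h⟩

theorem measurable_noise_past (M : Model Ω) {n k : ℕ} (h : n ≤ k) :
    Measurable[M.past n (k + 1)] (M.noise k) := by
  rw [measurable_iff_comap_le]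
  exact le_iSup₂_of_le k ⟨h, k.lt_succ_self⟩ le_rfl

theorem discountedCost_zero {S : Type} (T : ℕ → S → RetainedLoss → Ω → S)
    (d : (n : ℕ) → Hist S RetainedLoss n → RetainedLoss) (n : ℕ) (h : Hist S RetainedLoss n)
    (ω : Ω) : M.discountedCost T d n h 0 ω = 0 :=
  Finset.sum_range_zero _

theorem discountedCost_succ {S : Type} (T : ℕ → S → RetainedLoss → Ω → S)
    (d : (n : ℕ) → Hist S RetainedLoss n → RetainedLoss) (n : ℕ) (h : Hist S RetainedLoss n)
    (m : ℕ) (ω : Ω) : M.discountedCost T d n h (m + 1) ω =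
      M.discountedCost T d n h m ω +
        (M.β : ℝ) ^ m * M.cost (n + m) (d (n + m) (histFrom T d n h ω m)) ω :=
  Finset.sum_range_succ _ _

theorem measurable_histFrom {S : Type} [MeasurableSpace S] {T : ℕ → S → RetainedLoss → Ω → S}
    (hT : M.IsNoiseDriven T) {d : (n : ℕ) → Hist S RetainedLoss n → RetainedLoss}
    (hd : ∀ n, Measurable (d n)) (n : ℕ) (h : Hist S RetainedLoss n) (j : ℕ) :
    Measurable[M.past n (n + j)] fun ω => histFrom T d n h ω j := by
  induction j with
  | zero => exact @measurable_const _ _ _ (M.past n (n + 0)) h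
  | succ j ih =>
    have ih' : Measurable[M.past n (n + (j + 1))] fun ω => histFrom T d n h ω j :=
      ih.mono (M.past_mono n (by lia)) le_rfl
    obtain ⟨τ, hτ, hTτ⟩ := hT (n + j)
    have hd' := (hd (n + j)).comp ih'
    have h₁ := hτ.comp (((Hist.measurable_last (n + j)).comp ih').prodMk
      (hd'.prodMk (M.measurable_noise_past (Nat.le_add_right n j))))
    have h₂ := ih'.prodMk (hd'.prodMk h₁)
    simp only [histFrom, hTτ]
    exact h₂

namespace IsAdmissible

variable (hM : M.IsAdmissible)
include hM

theorem past_le (n m : ℕ) : M.past n m ≤ ‹MeasurableSpace Ω› :=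
  iSup₂_le fun i _ => (hM.measurable_noise i).comap_le

theorem indepFun_noise {n k : ℕ} {α : Type*} [MeasurableSpace α] {U : Ω → α}
    (hU : Measurable[M.past n k] U) : IndepFun U (M.noise k) M.P := by
  rw [IndepFun_iff_Indep]
  have hdisj : Disjoint (Set.Ico n k) {k} := by simp
  have h := indep_iSup_of_disjoint (fun i => (hM.measurable_noise i).comap_le)
    hM.indep.iIndep hdisj
  refine indep_of_indep_of_le_left (indep_of_indep_of_le_right h ?_) hU.comap_le
  exact le_iSup₂_of_le (f := fun i _ => MeasurableSpace.comap (M.noise i) inferInstance) k rfl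
    le_rfl

theorem measurable_discountedCost {S : Type} [MeasurableSpace S]
    {T : ℕ → S → RetainedLoss → Ω → S} (hT : M.IsNoiseDriven T)
    {d : (n : ℕ) → Hist S RetainedLoss n → RetainedLoss} (hd : ∀ n, Measurable (d n)) (n : ℕ)
    (h : Hist S RetainedLoss n) (j : ℕ) [IsProbabilityMeasure M.P] :
    Measurable[M.past n (n + j)] fun ω => M.discountedCost T d n h j ω := by
  induction j with
  | zero =>
    simp only [discountedCost_zero]
    exact @measurable_const _ _ _ (M.past n (n + 0)) (0 : ℝ)
  | succ j ih =>
    have hmono := M.past_mono n (show n + j ≤ n + (j + 1) by lia)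
    have hH := (measurable_histFrom hT hd n h j).mono hmono le_rfl
    have hc := (hM.measurable_costFun (n + j)).comp
      (((hd (n + j)).comp hH).prodMk (M.measurable_noise_past (Nat.le_add_right n j)))
    have h₁ := (ih.mono hmono le_rfl).add (hc.const_mul ((M.β : ℝ) ^ j))
    convert h₁ using 2 with ω
    exact discountedCost_succ T d n h j ω

variable [IsProbabilityMeasure M.P]

theorem integrable_discountedCost {S : Type} [MeasurableSpace S]
    {T : ℕ → S → RetainedLoss → Ω → S} (hT : M.IsNoiseDriven T)
    {d : (n : ℕ) → Hist S RetainedLoss n → RetainedLoss} (hd : ∀ n, Measurable (d n)) (n : ℕ)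
    (h : Hist S RetainedLoss n) (j : ℕ) :
    Integrable (fun ω => M.discountedCost T d n h j ω) M.P := by
  refine integrable_finsetSum _ fun i _ => (hM.integrable_cost _ ?_).const_mul _
  exact (hd _).comp ((measurable_histFrom hT hd n h i).mono (hM.past_le _ _) le_rfl)

theorem integrable_accumulated {S : Type} [MeasurableSpace S]
    {T : ℕ → S → RetainedLoss → Ω → S} (hT : M.IsNoiseDriven T)
    {d : (n : ℕ) → Hist S RetainedLoss n → RetainedLoss} (hd : ∀ n, Measurable (d n)) (n : ℕ)
    (h : Hist S RetainedLoss n) (s t : ℝ) (j : ℕ) :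
    Integrable (fun ω => s + t * M.discountedCost T d n h j ω) M.P :=
  (integrable_const s).add ((hM.integrable_discountedCost hT hd n h j).const_mul t)

/-- Conditioning on the information before time `k`. -/
theorem integral_step {L K : ℝ≥0} {v : ℝ → ℝ → ℝ} (hv : IsRegular L K v) {n k : ℕ} {A : Ω → ℝ}
    {F : Ω → RetainedLoss} (hA : Measurable[M.past n k] A) (hF : Measurable[M.past n k] F)
    (hint : Integrable A M.P) (t : ℝ) :
    Integrable (fun ω => M.stepValue k v (A ω) t (F ω)) M.P ∧
      ∫ ω, v (A ω + t * M.cost k (F ω) ω) (M.β * t) ∂M.P =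
        ∫ ω, M.stepValue k v (A ω) t (F ω) ∂M.P := by
  have hF' : Measurable F := hF.mono (hM.past_le n k) le_rfl
  let Φ : (ℝ × RetainedLoss) × ℝ≥0 × ℝ → ℝ := fun p =>
    v (p.1.1 + t * M.costFun k (p.1.2, p.2)) (M.β * t)
  have hΦ : Measurable Φ := by
    have h₁ : Measurable fun p : (ℝ × RetainedLoss) × ℝ≥0 × ℝ => M.costFun k (p.1.2, p.2) :=
      (hM.measurable_costFun k).comp
        ((measurable_snd.comp measurable_fst).prodMk measurable_snd)
    exact (hv.continuous_left _).measurable.comp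
      ((measurable_fst.comp measurable_fst).add (h₁.const_mul t))
  exact integral_comp_of_indepFun ((hA.prodMk hF).mono (hM.past_le n k) le_rfl)
    (hM.measurable_noise k) (hM.indepFun_noise (hA.prodMk hF)) hΦ
    (hv.integrable_comp (hM.integrable_next_cost k hint t hF') _)

/-! ### Verification -/

variable {L : ℝ≥0} {r : ℝ} {g : ℝ → ℝ} (hg : IsDisutility L r g)
  {S : Type} [MeasurableSpace S] {T : ℕ → S → RetainedLoss → Ω → S} (hT : M.IsNoiseDriven T)
  {d : (n : ℕ) → Hist S RetainedLoss n → RetainedLoss} (hd : ∀ n, Measurable (d n))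
include hg hT hd

theorem integrable_disutility (n : ℕ) (h : Hist S RetainedLoss n) (s t : ℝ) (m : ℕ) :
    Integrable (fun ω => g (s + t * M.discountedCost T d n h m ω)) M.P :=
  (IsRegular.of_isDisutility hg).integrable_comp (hM.integrable_accumulated hT hd n h s t m) 0

theorem integral_optValue_succ (n : ℕ) (h : Hist S RetainedLoss n) (s t : ℝ) (j m : ℕ) :
    let A := fun ω => s + t * M.discountedCost T d n h j ω
    let F := fun ω => d (n + j) (histFrom T d n h ω j)
    Integrable (fun ω => M.stepValue (n + j) (M.optValue g m (n + j + 1)) (A ω)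
        ((M.β : ℝ) ^ j * t) (F ω)) M.P ∧
      ∫ ω, M.optValue g m (n + (j + 1)) (s + t * M.discountedCost T d n h (j + 1) ω)
          ((M.β : ℝ) ^ (j + 1) * t) ∂M.P =
        ∫ ω, M.stepValue (n + j) (M.optValue g m (n + j + 1)) (A ω) ((M.β : ℝ) ^ j * t)
          (F ω) ∂M.P := by
  intro A F
  obtain ⟨K, hK⟩ := hM.exists_isRegular_optValue hg m (n + j + 1)
  have hA : Measurable[M.past n (n + j)] A :=
    ((hM.measurable_discountedCost hT hd n h j).const_mul t).const_add s
  have h₁ := hM.integral_step hK hA ((hd _).comp (measurable_histFrom hT hd n h j))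
    (hM.integrable_accumulated hT hd n h s t j) ((M.β : ℝ) ^ j * t)
  refine ⟨h₁.1, Eq.trans ?_ h₁.2⟩
  congr 1 with ω
  rw [discountedCost_succ, pow_succ', mul_assoc, ← add_assoc n j 1]
  congr 1
  simp only [A, Function.comp_apply]
  ring

theorem optValue_le_integral (n : ℕ) (h : Hist S RetainedLoss n) (s t : ℝ) (m : ℕ) :
    M.optValue g m n s t ≤ ∫ ω, g (s + t * M.discountedCost T d n h m ω) ∂M.P := by
  have key : ∀ j m, M.optValue g (m + j) n s t ≤
      ∫ ω, M.optValue g m (n + j) (s + t * M.discountedCost T d n h j ω)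
        ((M.β : ℝ) ^ j * t) ∂M.P := by
    intro j
    induction j with
    | zero => simp [discountedCost_zero]
    | succ j ih =>
      intro m
      have h₁ := hM.integral_optValue_succ hg hT hd n h s t j m
      obtain ⟨K, hK⟩ := hM.exists_isRegular_optValue hg (m + 1) (n + j)
      rw [h₁.2, show m + (j + 1) = m + 1 + j by ring]
      exact (ih (m + 1)).trans (integral_mono
        (hK.integrable_comp (hM.integrable_accumulated hT hd n h s t j) _) h₁.1
        fun ω => hM.optValue_succ_le hg _ _ _ _ _)
  simpa [optValue] using key m 0

theorem integral_eq_optValue (n : ℕ) (h : Hist S RetainedLoss n) (s t : ℝ) (m : ℕ)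
    (hopt : ∀ j k, k + 1 + j = m → ∀ᵐ ω ∂M.P,
      M.stepValue (n + j) (M.optValue g k (n + j + 1)) (s + t * M.discountedCost T d n h j ω)
          ((M.β : ℝ) ^ j * t) (d (n + j) (histFrom T d n h ω j)) =
        M.optValue g (k + 1) (n + j) (s + t * M.discountedCost T d n h j ω)
          ((M.β : ℝ) ^ j * t)) :
    ∫ ω, g (s + t * M.discountedCost T d n h m ω) ∂M.P = M.optValue g m n s t := by
  have key : ∀ j k, k + j = m →
      ∫ ω, M.optValue g k (n + j) (s + t * M.discountedCost T d n h j ω)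
        ((M.β : ℝ) ^ j * t) ∂M.P = M.optValue g m n s t := by
    intro j
    induction j with
    | zero =>
      rintro k rfl
      simp [discountedCost_zero]
    | succ j ih =>
      intro k hk
      rw [(hM.integral_optValue_succ hg hT hd n h s t j k).2, ← ih (k + 1) (by lia)]
      exact integral_congr_ae (hopt j k (by lia))
  simpa [optValue] using key m 0 (by simp)

end IsAdmissible

/-! ### The processes of the original and the extended model -/

theorem coe_extNext (k : ℕ) (e : ExtState) (f : RetainedLoss) (ω : Ω) (h : 0 ≤ M.cost k f ω) :
    ((M.extNext k e f ω).2.1 : ℝ) = e.2.1 + e.2.2 * M.cost k f ω ∧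
      ((M.extNext k e f ω).2.2 : ℝ) = M.β * e.2.2 :=
  ⟨Real.coe_toNNReal _ (add_nonneg NNReal.zero_le_coe (mul_nonneg e.2.2.2.1.le h)), rfl⟩

theorem coe_toExt_succ {k : ℕ} (h : Hist ℝ RetainedLoss k) (f : RetainedLoss) (ω : Ω)
    (hc : 0 ≤ M.cost k f ω) :
    let h' : Hist ℝ RetainedLoss (k + 1) := (h, f, M.next k h.last f ω)
    ((M.toExt h').2.1 : ℝ) = (M.toExt h).2.1 + (M.toExt h).2.2 * M.cost k f ω ∧
      ((M.toExt h').2.2 : ℝ) = M.β * (M.toExt h).2.2 := by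
  intro h'
  have hcost : h.last - M.next k h.last f ω + M.zhat k = M.cost k f ω := by
    rw [next, cost]
    ring
  refine ⟨?_, rfl⟩
  rw [← hcost] at hc ⊢
  exact Real.coe_toNNReal _ (add_nonneg NNReal.zero_le_coe (mul_nonneg (M.toExt h).2.2.2.1.le hc))

theorem measurable_toExt : ∀ n, Measurable (M.toExt : Hist ℝ RetainedLoss n → ExtState)
  | 0 => measurable_id.prodMk measurable_const
  | n + 1 => by
    have h₁ : Measurable fun h : Hist ℝ RetainedLoss n × RetainedLoss × ℝ => M.toExt h.1 :=
      (measurable_toExt n).comp measurable_fst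
    have h₂ : Measurable fun h : Hist ℝ RetainedLoss n × RetainedLoss × ℝ => h.1.last :=
      (Hist.measurable_last n).comp measurable_fst
    have h₃ : Measurable fun t : Set.Ioc (0 : ℝ) 1 => M.β * t :=
      (measurable_subtype_coe.const_mul (M.β : ℝ)).subtype_mk
    have h₄ : Measurable fun h : Hist ℝ RetainedLoss n × RetainedLoss × ℝ =>
        ((h.2.2, Real.toNNReal ((M.toExt h.1).2.1 +
          (M.toExt h.1).2.2 * (h.1.last - h.2.2 + M.zhat n)), M.β * (M.toExt h.1).2.2) :
          ExtState) := by
      fun_prop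
    exact h₄

namespace IsAdmissible

variable (hM : M.IsAdmissible)
include hM

/-- Almost surely, the extended state consists of the surplus, the accumulated cost and the
discount factor. -/
theorem ae_last_histFrom_extNext (d : (n : ℕ) → Hist ExtState RetainedLoss n → RetainedLoss)
    (n : ℕ) (h : Hist ExtState RetainedLoss n) (j : ℕ) : ∀ᵐ ω ∂M.P,
      ((histFrom M.extNext d n h ω j).last.2.1 : ℝ) =
          h.last.2.1 + h.last.2.2 * M.discountedCost M.extNext d n h j ω ∧
        ((histFrom M.extNext d n h ω j).last.2.2 : ℝ) = (M.β : ℝ) ^ j * h.last.2.2 := by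
  filter_upwards [hM.ae_cost_nonneg] with ω hω
  induction j with
  | zero =>
    rw [discountedCost_zero, mul_zero, pow_zero]
    exact ⟨(add_zero _).symm, (one_mul _).symm⟩
  | succ j ih =>
    have h₁ := coe_extNext (n + j) (histFrom M.extNext d n h ω j).last
      (d (n + j) (histFrom M.extNext d n h ω j)) ω (hω _ _)
    rw [ih.1, ih.2] at h₁
    rw [discountedCost_succ]
    exact ⟨h₁.1.trans (by ring), h₁.2.trans (by ring)⟩

theorem ae_toExt_histFrom_next (d : (n : ℕ) → Hist ℝ RetainedLoss n → RetainedLoss)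
    (x : Hist ℝ RetainedLoss 0) (j : ℕ) : ∀ᵐ ω ∂M.P,
      ((M.toExt (histFrom M.next d 0 x ω j)).2.1 : ℝ) = M.discountedCost M.next d 0 x j ω ∧
        ((M.toExt (histFrom M.next d 0 x ω j)).2.2 : ℝ) = (M.β : ℝ) ^ j := by
  filter_upwards [hM.ae_cost_nonneg] with ω hω
  induction j with
  | zero =>
    rw [discountedCost_zero, pow_zero]
    exact ⟨rfl, rfl⟩
  | succ j ih =>
    have h₁ := coe_toExt_succ (histFrom M.next d 0 x ω j)
      (d (0 + j) (histFrom M.next d 0 x ω j)) ω (hω _ _)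
    rw [ih.1, ih.2] at h₁
    rw [discountedCost_succ]
    exact ⟨h₁.1.trans (by ring), h₁.2.trans (by ring)⟩

theorem ae_extNext_eq (n : ℕ) (v : ℝ → ℝ → ℝ) (e : ExtState) (f : RetainedLoss) :
    (fun ω => v (M.extNext n e f ω).2.1 (M.extNext n e f ω).2.2) =ᵐ[M.P]
      fun ω => v (e.2.1 + e.2.2 * M.cost n f ω) (M.β * e.2.2) := by
  filter_upwards [hM.ae_cost_nonneg] with ω hω
  have h := coe_extNext n e f ω (hω _ _)
  rw [h.1, h.2]

theorem opL_eq_stepValue (n : ℕ) (v : ℝ → ℝ → ℝ) (e : ExtState) (f : RetainedLoss) :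
    M.opL n (fun e => v e.2.1 e.2.2) e f = M.stepValue n v e.2.1 e.2.2 f :=
  integral_congr_ae (hM.ae_extNext_eq n v e f)

variable [IsProbabilityMeasure M.P]

theorem isNoiseDriven_next : M.IsNoiseDriven M.next := fun k =>
  ⟨fun p => p.1 - p.2.1 p.2.2.1 - M.premium k p.2.1 + p.2.2.2, by
    have h₁ : Measurable fun p : ℝ × RetainedLoss × ℝ≥0 × ℝ => (p.2.1 p.2.2.1 : ℝ) :=
      (RetainedLoss.measurable_uncurry.comp (f := fun p : ℝ × RetainedLoss × ℝ≥0 × ℝ =>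
        (p.2.1, p.2.2.1)) (by fun_prop)).coe_nnreal_real
    have h₂ : Measurable fun p : ℝ × RetainedLoss × ℝ≥0 × ℝ => M.premium k p.2.1 :=
      (hM.measurable_premium k).comp (measurable_fst.comp measurable_snd)
    fun_prop, fun _ _ _ => rfl⟩

theorem isNoiseDriven_extNext : M.IsNoiseDriven M.extNext := fun k => by
  obtain ⟨τ, hτ, hnext⟩ := hM.isNoiseDriven_next k
  refine ⟨fun p => (τ (p.1.1, p.2), Real.toNNReal (p.1.2.1 + p.1.2.2 * M.costFun k p.2),
    M.β * p.1.2.2), ?_, fun e f ω => ?_⟩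
  · have h₁ := hM.measurable_costFun k
    have h₂ : Measurable fun t : Set.Ioc (0 : ℝ) 1 => M.β * t :=
      (measurable_subtype_coe.const_mul (M.β : ℝ)).subtype_mk
    fun_prop
  · rw [extNext, hnext, cost_eq_costFun]

theorem measurable_extNext (k : ℕ) :
    Measurable fun p : (ExtState × RetainedLoss) × Ω => M.extNext k p.1.1 p.1.2 p.2 := by
  obtain ⟨τ, hτ, hnext⟩ := hM.isNoiseDriven_extNext k
  simp only [hnext]
  have := hM.measurable_noise k
  fun_prop

/-! ### Value functions on the extended state space -/

theorem integrable_extNext_of_le {L : ℝ≥0} {c : ℝ} {v : ExtState → ℝ} (hv : Measurable v)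
    (hb : ∀ e, 0 ≤ v e ∧ v e ≤ c + L * e.2.1) (n : ℕ) (e : ExtState) (f : RetainedLoss) :
    Integrable (fun ω => v (M.extNext n e f ω)) M.P ∧
      M.opL n v e f ≤ c + L * ∫ ω, M.costBound n ω ∂M.P + L * e.2.1 := by
  have hint₁ : Integrable (fun ω => c + L * M.costBound n ω) M.P :=
    (integrable_const _).add ((hM.integrable_costBound n).const_mul _)
  have hint : Integrable (fun ω => c + L * M.costBound n ω + L * e.2.1) M.P :=
    hint₁.add (integrable_const _)
  have hle : ∀ ω, v (M.extNext n e f ω) ≤ c + L * M.costBound n ω + L * e.2.1 := fun ω => by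
    refine (hb _).2.trans ?_
    have h₁ : ((M.extNext n e f ω).2.1 : ℝ) ≤ e.2.1 + M.costBound n ω := by
      have h₂ := hM.abs_cost_le n f ω
      have h₃ : (e.2.2 : ℝ) * M.cost n f ω ≤ M.costBound n ω := by
        refine (le_abs_self _).trans ?_
        rw [abs_mul, abs_of_pos e.2.2.2.1]
        exact (mul_le_of_le_one_left (abs_nonneg _) e.2.2.2.2).trans h₂
      simp only [extNext, Real.coe_toNNReal']
      exact max_le (by linarith)
        (add_nonneg NNReal.zero_le_coe ((abs_nonneg _).trans h₂))
    have := mul_le_mul_of_nonneg_left h₁ L.2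
    simp only [NNReal.val_eq_coe] at this
    linarith
  have hi : Integrable (fun ω => v (M.extNext n e f ω)) M.P := by
    refine hint.mono' (hv.comp ((hM.measurable_extNext n).comp
      (measurable_prodMk_left (x := (e, f))))).aestronglyMeasurable (.of_forall fun ω => ?_)
    rw [Real.norm_of_nonneg (hb _).1]
    exact hle ω
  refine ⟨hi, (integral_mono hi hint hle).trans_eq ?_⟩
  rw [integral_add hint₁ (integrable_const _), integral_add (integrable_const _)
    ((hM.integrable_costBound n).const_mul _), integral_const_mul]
  simp

variable {L : ℝ≥0} {r : ℝ} {g : ℝ → ℝ} (hg : IsDisutility L r g)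
include hg

theorem measurable_markovValueAux {d : ℕ → ExtState → RetainedLoss} (hd : ∀ k, Measurable (d k))
    (m n : ℕ) : Measurable (M.markovValueAux g d m n) ∧
      ∃ c : ℝ, ∀ e, 0 ≤ M.markovValueAux g d m n e ∧
        M.markovValueAux g d m n e ≤ c + L * e.2.1 := by
  induction m generalizing n with
  | zero =>
    refine ⟨hg.2.2.1.continuous.measurable.comp
      (measurable_fst.comp measurable_snd).coe_nnreal_real, r, fun e => ?_⟩
    have h := hg.2.2.2 e.2.1
    rw [max_eq_left NNReal.zero_le_coe, add_comm] at h
    exact h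
  | succ m ih =>
    obtain ⟨hm, c, hc⟩ := ih (n + 1)
    refine ⟨?_, c + L * ∫ ω, M.costBound n ω ∂M.P, fun e => ⟨?_, ?_⟩⟩
    · have h₁ : Measurable fun p : ExtState × Ω =>
          M.markovValueAux g d m (n + 1) (M.extNext n p.1 (d n p.1) p.2) :=
        hm.comp ((hM.measurable_extNext n).comp
          ((measurable_fst.prodMk ((hd n).comp measurable_fst)).prodMk measurable_snd))
      exact (StronglyMeasurable.integral_prod_right (ν := M.P) (f := fun (e : ExtState) ω =>
        M.markovValueAux g d m (n + 1) (M.extNext n e (d n e) ω)) h₁.stronglyMeasurable).measurable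
    · exact integral_nonneg fun ω => (hc _).1
    · exact (hM.integrable_extNext_of_le hm hc n e _).2

theorem optValue_le_markovValueAux {d : ℕ → ExtState → RetainedLoss}
    (hd : ∀ k, Measurable (d k)) (m n : ℕ) (e : ExtState) :
    M.optValue g m n e.2.1 e.2.2 ≤ M.markovValueAux g d m n e := by
  induction m generalizing n e with
  | zero => exact le_rfl
  | succ m ih =>
    obtain ⟨hm, c, hc⟩ := hM.measurable_markovValueAux hg hd m (n + 1)
    obtain ⟨K, hK⟩ := hM.exists_isRegular_optValue hg m (n + 1)
    refine (hM.optValue_succ_le hg m n e.2.1 e.2.2 (d n e)).trans ?_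
    rw [← hM.opL_eq_stepValue]
    refine integral_mono ?_ (hM.integrable_extNext_of_le hm hc n e (d n e)).1 fun ω => ih _ _
    exact (hM.integrable_step hK n _ _ _ _).congr (hM.ae_extNext_eq n _ e _).symm

theorem exists_measurable_stopLoss_seq (N : ℕ) :
    ∃ a : ℕ → ExtState → ℝ≥0∞, (∀ n, Measurable (a n)) ∧ ∀ m n, m + 1 + n = N →
      ∀ e : ExtState, M.stepValue n (M.optValue g m (n + 1)) e.2.1 e.2.2 (stopLoss (a n e)) =
        M.optValue g (m + 1) n e.2.1 e.2.2 := by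
  choose a ham ha using hM.exists_measurable_stopLoss hg
  refine ⟨fun n => a (N - n - 1) n, fun n => ham _ _, fun m n hmn e => ?_⟩
  obtain rfl : m = N - n - 1 := by lia
  exact ha _ _ _

theorem valueJ_eq_optValue (N n : ℕ) (e : ExtState) :
    M.valueJ g N n e = M.optValue g (N - n) n e.2.1 e.2.2 := by
  have hle : ∀ d : {d : ℕ → ExtState → RetainedLoss // ∀ k, Measurable (d k)},
      M.optValue g (N - n) n e.2.1 e.2.2 ≤ M.markovValueAux g d.1 (N - n) n e := fun d =>
    hM.optValue_le_markovValueAux hg d.2 _ _ _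
  obtain ⟨a, ham, ha⟩ := hM.exists_measurable_stopLoss_seq hg N
  let d : {d : ℕ → ExtState → RetainedLoss // ∀ k, Measurable (d k)} :=
    ⟨fun k e => stopLoss (a k e), fun k => continuous_stopLoss.measurable.comp (ham k)⟩
  have hd : ∀ m n, m + n ≤ N → (m = 0 ∨ m + n = N) → ∀ e : ExtState,
      M.markovValueAux g d.1 m n e = M.optValue g m n e.2.1 e.2.2 := by
    intro m
    induction m with
    | zero => exact fun _ _ _ _ => rfl
    | succ m ih =>
      intro n _ hmn e
      have hv : M.markovValueAux g d.1 m (n + 1) =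
          fun e => M.optValue g m (n + 1) e.2.1 e.2.2 :=
        funext fun e => ih (n + 1) (by lia) (by lia) e
      rw [markovValueAux, hv, hM.opL_eq_stepValue]
      exact ha m n (by lia) e
  refine le_antisymm ((ciInf_le ⟨_, Set.forall_mem_range.2 hle⟩ d).trans_eq ?_) ?_
  · rcases le_total n N with h | h
    · exact hd _ _ (by lia) (by lia) e
    · rw [Nat.sub_eq_zero_of_le h]
      rfl
  · have : Nonempty {d : ℕ → ExtState → RetainedLoss // ∀ k, Measurable (d k)} := ⟨d⟩
    exact le_ciInf hle

theorem opL_valueJ_eq_stepValue {N n m : ℕ} (h : m + 1 + n = N) (e : ExtState)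
    (f : RetainedLoss) :
    M.opL n (M.valueJ g N (n + 1)) e f =
      M.stepValue n (M.optValue g m (n + 1)) e.2.1 e.2.2 f := by
  obtain rfl : m = N - (n + 1) := by lia
  rw [← hM.opL_eq_stepValue]
  congr 1
  exact funext fun e => hM.valueJ_eq_optValue hg N (n + 1) e

theorem optValue_le_policyValue (N : ℕ) (π : Policy ExtState RetainedLoss) (n : ℕ)
    (h : Hist ExtState RetainedLoss n) :
    M.optValue g (N - n) n h.last.2.1 h.last.2.2 ≤ M.policyValue g N π n h :=
  hM.optValue_le_integral hg hM.isNoiseDriven_extNext π.2 n h _ _ _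

theorem optValue_le_innerValue (N : ℕ) (π : Policy ℝ RetainedLoss) (x : ℝ) :
    M.optValue g N 0 0 1 ≤ M.innerValue g N π x := by
  have := hM.optValue_le_integral hg hM.isNoiseDriven_next π.2 0 x 0 1 N
  simp only [zero_add, one_mul] at this
  exact this

variable {N : ℕ} {a : ℕ → ExtState → ℝ≥0∞}
  (ha : ∀ m n, m + 1 + n = N → ∀ e : ExtState,
    M.stepValue n (M.optValue g m (n + 1)) e.2.1 e.2.2 (stopLoss (a n e)) =
      M.optValue g (m + 1) n e.2.1 e.2.2)
include ha

theorem policyValue_eq_optValue {π : Policy ExtState RetainedLoss}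
    (hπ : ∀ (n : ℕ) (h : Hist ExtState RetainedLoss n), π.1 n h = stopLoss (a n h.last)) {n : ℕ}
    (hn : n ≤ N) (h : Hist ExtState RetainedLoss n) :
    M.policyValue g N π n h = M.optValue g (N - n) n h.last.2.1 h.last.2.2 := by
  refine hM.integral_eq_optValue hg hM.isNoiseDriven_extNext π.2 n h _ _ _ fun j k hjk => ?_
  filter_upwards [hM.ae_last_histFrom_extNext π.1 n h j] with ω hω
  rw [hπ, ← hω.1, ← hω.2]
  exact ha k (n + j) (by lia) _

theorem innerValue_eq_optValue {π : Policy ℝ RetainedLoss}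
    (hπ : ∀ (n : ℕ) (h : Hist ℝ RetainedLoss n), π.1 n h = stopLoss (a n (M.toExt h))) (x : ℝ) :
    M.innerValue g N π x = M.optValue g N 0 0 1 := by
  have := hM.integral_eq_optValue hg hM.isNoiseDriven_next π.2 0 x 0 1 N fun j k hjk => by
    filter_upwards [hM.ae_toExt_histFrom_next π.1 x j] with ω hω
    have h₁ := ha k (0 + j) (by lia) (M.toExt (histFrom M.next π.1 0 x ω j))
    rw [hω.1, hω.2] at h₁
    have h₂ : ∀ y : ℝ, 0 + y = y := zero_add
    rw [hπ, one_mul, mul_one, h₂]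
    exact h₁
  simp only [zero_add, one_mul] at this
  exact this

theorem valueV_eq_optValue (ham : ∀ n, Measurable (a n)) {n : ℕ} (hn : n ≤ N)
    (h : Hist ExtState RetainedLoss n) :
    M.valueV g N n h = M.optValue g (N - n) n h.last.2.1 h.last.2.2 := by
  let π : Policy ExtState RetainedLoss := ⟨fun n h => stopLoss (a n h.last), fun n =>
    continuous_stopLoss.measurable.comp ((ham n).comp (Hist.measurable_last n))⟩
  have hle := fun π => hM.optValue_le_policyValue hg N π n h
  have : Nonempty (Policy ExtState RetainedLoss) := ⟨π⟩
  exact le_antisymm ((ciInf_le ⟨_, Set.forall_mem_range.2 hle⟩ π).trans_eq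
    (hM.policyValue_eq_optValue hg ha (fun _ _ => rfl) hn h)) (le_ciInf hle)

theorem innerOpt_eq_optValue {π : Policy ℝ RetainedLoss}
    (hπ : ∀ (n : ℕ) (h : Hist ℝ RetainedLoss n), π.1 n h = stopLoss (a n (M.toExt h))) (x : ℝ) :
    M.innerOpt g N x = M.optValue g N 0 0 1 := by
  have hle := fun π => hM.optValue_le_innerValue hg N π x
  have : Nonempty (Policy ℝ RetainedLoss) := ⟨π⟩
  exact le_antisymm ((ciInf_le ⟨_, Set.forall_mem_range.2 hle⟩ π).trans_eq
    (hM.innerValue_eq_optValue hg ha hπ x)) (le_ciInf hle)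

end IsAdmissible

end Model

end Reinsurance

open Reinsurance in
theorem mainTheorem9 {Ω : Type*} [MeasurableSpace Ω] (M : Model Ω) [IsProbabilityMeasure M.P]
    -- claims are integrable, premium incomes are bounded, both are nonnegative
    (hYm : ∀ k, Measurable (M.Y k))
    (hY : ∀ k, Integrable (fun ω => (M.Y k ω : ℝ)) M.P)
    (hZm : ∀ k, Measurable (M.Z k))
    (hZ : ∀ k, MemLp (M.Z k) ∞ M.P)
    (hZ0 : ∀ k, 0 ≤ᵐ[M.P] M.Z k)
    -- the disturbances are independent over time, and claims are independent of premium incomes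
    (hindep : iIndepFun (fun k ω => (M.Y k ω, M.Z k ω)) M.P)
    (hYZ : ∀ k, IndepFun (M.Y k) (M.Z k) M.P)
    (hθ : 0 < M.θ)
    (N : ℕ) (L : ℝ≥0) (r : ℝ) (g : ℝ → ℝ) (hg : IsDisutility L r g) :
    -- for every treaty some stop-loss treaty retains less risk in the convex order
    (∀ (k : ℕ) (f : RetainedLoss), ∃ a : ℝ≥0∞,
      ConvexOrder M.P (fun ω => (stopLoss a (M.Y k ω) : ℝ)) (fun ω => (f (M.Y k ω) : ℝ))) ∧
    -- all the expectations involved are finite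
    (∀ (π : Policy ℝ RetainedLoss) (x : ℝ),
      Integrable (fun ω => g (M.discountedCost M.next π.1 0 x N ω)) M.P) ∧
    (∀ (π : Policy ExtState RetainedLoss) (n : ℕ), n ≤ N → ∀ h : Hist ExtState RetainedLoss n,
      Integrable (fun ω => g (h.last.2.1 +
        h.last.2.2 * M.discountedCost M.extNext π.1 n h (N - n) ω)) M.P) ∧
    (∀ n < N, ∀ (e : ExtState) (f : RetainedLoss),
      Integrable (fun ω => M.valueJ g N (n + 1) (M.extNext n e f ω)) M.P) ∧
    -- the value functions depend on the current extended state only and are convex in `(x, s)`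
    (∀ n ≤ N, ∀ h : Hist ExtState RetainedLoss n, M.valueV g N n h = M.valueJ g N n h.last) ∧
    (∀ n ≤ N, ∀ t : Set.Ioc (0 : ℝ) 1,
      ConvexOn ℝ≥0 Set.univ (fun p : ℝ × ℝ≥0 => M.valueJ g N n (p.1, p.2, t))) ∧
    -- Bellman equation; a stop-loss treaty as above is at least as good as `f`, so that it
    -- suffices to minimize over stop-loss treaties
    (∀ e : ExtState, M.valueJ g N N e = g e.2.1) ∧
    (∀ n < N, ∀ e : ExtState,
      (∀ (f : RetainedLoss) (a : ℝ≥0∞),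
        ConvexOrder M.P (fun ω => (stopLoss a (M.Y n ω) : ℝ)) (fun ω => (f (M.Y n ω) : ℝ)) →
        M.opL n (M.valueJ g N (n + 1)) e (stopLoss a) ≤ M.opL n (M.valueJ g N (n + 1)) e f) ∧
      IsLeast (Set.range fun f : RetainedLoss => M.opL n (M.valueJ g N (n + 1)) e f)
        (M.valueJ g N n e) ∧
      IsLeast (Set.range fun a : ℝ≥0∞ => M.opL n (M.valueJ g N (n + 1)) e (stopLoss a))
        (M.valueJ g N n e)) ∧
    -- there are measurable parameters attaining the minimum at every stage, ...
    (∃ a : ℕ → ExtState → ℝ≥0∞, (∀ n, Measurable (a n)) ∧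
      ∀ n < N, ∀ e : ExtState,
        M.opL n (M.valueJ g N (n + 1)) e (stopLoss (a n e)) = M.valueJ g N n e) ∧
    -- ... and all such parameters give stop-loss policies which are optimal
    (∀ a : ℕ → ExtState → ℝ≥0∞, (∀ n, Measurable (a n)) →
      (∀ n < N, ∀ e : ExtState,
        M.opL n (M.valueJ g N (n + 1)) e (stopLoss (a n e)) = M.valueJ g N n e) →
      (∃ π : Policy ExtState RetainedLoss,
        (∀ (n : ℕ) (h : Hist ExtState RetainedLoss n), π.1 n h = stopLoss (a n h.last)) ∧
        ∀ n ≤ N, ∀ h : Hist ExtState RetainedLoss n,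
          M.policyValue g N π n h = M.valueV g N n h) ∧
      (∃ π : Policy ℝ RetainedLoss,
        (∀ (n : ℕ) (h : Hist ℝ RetainedLoss n), π.1 n h = stopLoss (a n (M.toExt h))) ∧
        ∀ x : ℝ, M.innerValue g N π x = M.innerOpt g N x ∧
          M.innerOpt g N x = M.valueJ g N 0 (x, 0, ⟨1, by norm_num⟩))) := by
  have hM : M.IsAdmissible := ⟨hYm, hY, hZm, hZ, hindep, hYZ, hθ⟩
  obtain ⟨a, ham, ha⟩ := hM.exists_measurable_stopLoss_seq hg N
  have hJ := hM.valueJ_eq_optValue hg N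
  have hopL : ∀ n < N, ∀ (e : ExtState) (f : RetainedLoss),
      M.opL n (M.valueJ g N (n + 1)) e f =
        M.stepValue n (M.optValue g (N - n - 1) (n + 1)) e.2.1 e.2.2 f := fun n hn e f =>
    hM.opL_valueJ_eq_stepValue hg (by lia) e f
  have hJ' : ∀ n < N, ∀ e : ExtState,
      M.valueJ g N n e = M.optValue g (N - n - 1 + 1) n e.2.1 e.2.2 := fun n hn e => by
    rw [hJ, show N - n - 1 + 1 = N - n by lia]
  have hmin : ∀ n < N, ∀ (e : ExtState) (f : RetainedLoss),
      M.valueJ g N n e ≤ M.opL n (M.valueJ g N (n + 1)) e f := fun n hn e f => by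
    rw [hopL n hn, hJ' n hn]
    exact hM.optValue_succ_le hg _ n _ _ f
  have hatt : ∀ n < N, ∀ e : ExtState,
      M.opL n (M.valueJ g N (n + 1)) e (stopLoss (a n e)) = M.valueJ g N n e := fun n hn e => by
    rw [hopL n hn, hJ' n hn]
    exact ha _ n (by lia) e
  refine ⟨fun k f => exists_convexOrder_stopLoss (hYm k) (hY k) f, fun π x => ?_,
    fun π n _ h => hM.integrable_disutility hg hM.isNoiseDriven_extNext π.2 n h _ _ _,
    fun n _ e f => ?_, fun n hn h => ?_, fun n _ t => ?_, fun e => ?_,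
    fun n hn e => ⟨fun f a h => ?_, ⟨⟨_, hatt n hn e⟩, ?_⟩, ⟨⟨_, hatt n hn e⟩, ?_⟩⟩,
    ⟨a, ham, hatt⟩, fun a ham hatt => ?_⟩
  · have := hM.integrable_disutility hg hM.isNoiseDriven_next π.2 0 x 0 1 N
    simpa only [zero_add, one_mul] using this
  · obtain ⟨K, hK⟩ := hM.exists_isRegular_optValue hg (N - (n + 1)) (n + 1)
    simp only [hJ]
    exact (hM.integrable_step hK n _ _ _ f).congr (hM.ae_extNext_eq n _ e f).symm
  · rw [hM.valueV_eq_optValue hg ha ham hn, hJ]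
  · obtain ⟨K, hK⟩ := hM.exists_isRegular_optValue hg (N - n) n
    simp only [hJ]
    refine ⟨convex_univ, fun p _ q _ b c hb hc hbc => ?_⟩
    exact (hK.convexOn t).2 (Set.mem_univ (p.2 : ℝ)) (Set.mem_univ (q.2 : ℝ)) b.2 c.2
      (congrArg NNReal.toReal hbc)
  · rw [hJ, Nat.sub_self]
    rfl
  · obtain ⟨K, hK⟩ := hM.exists_isRegular_optValue hg (N - n - 1) (n + 1)
    rw [hopL n hn, hopL n hn]
    exact hM.stepValue_stopLoss_le hK n _ _ h
  · exact Set.forall_mem_range.2 (hmin n hn e)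
  · exact Set.forall_mem_range.2 fun a => hmin n hn e (stopLoss a)
  · have ha : ∀ m n, m + 1 + n = N → ∀ e : ExtState,
        M.stepValue n (M.optValue g m (n + 1)) e.2.1 e.2.2 (stopLoss (a n e)) =
          M.optValue g (m + 1) n e.2.1 e.2.2 := fun m n hmn e => by
      rw [← hM.opL_valueJ_eq_stepValue hg hmn, hatt n (by lia) e, hJ,
        show N - n = m + 1 by lia]
    let π : Policy ℝ RetainedLoss := ⟨fun n h => stopLoss (a n (M.toExt h)), fun n =>
      continuous_stopLoss.measurable.comp ((ham n).comp (M.measurable_toExt n))⟩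
    let π' : Policy ExtState RetainedLoss := ⟨fun n h => stopLoss (a n h.last), fun n =>
      continuous_stopLoss.measurable.comp ((ham n).comp (Hist.measurable_last n))⟩
    refine ⟨⟨π', fun _ _ => rfl, fun n hn h => ?_⟩,
      ⟨π, fun _ _ => rfl, fun x => ⟨?_, ?_⟩⟩⟩
    · rw [hM.policyValue_eq_optValue hg ha (π := π') (fun _ _ => rfl) hn,
        hM.valueV_eq_optValue hg ha ham hn]
    · rw [hM.innerValue_eq_optValue hg ha (π := π) (fun _ _ => rfl),
        hM.innerOpt_eq_optValue hg ha (π := π) fun _ _ => rfl]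
    · rw [hM.innerOpt_eq_optValue hg ha (π := π) fun _ _ => rfl, hJ]
      simp
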